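/- All graphs are finite and simple. A graph $G$ is $H$-free if no induced subgraph of $G$ is isomorphic to $H$. An $(x,y)$-pair in $G$ is a pair $(A,B)$ of disjoint sets of vertices with $|A|\ge x$ and $|B|\ge y$. It is complete (anticomplete) if every (no) vertex of $A$ is adjacent to every (any) vertex of $B$. For real $c \ge 0$ it is $c$-sparse if there are at most $c|A||B|$ edges between $A$ and $B$, and $c$-dense if there are at least $c|A||B|$ such edges. A copy of $H$ in $G$ is an isomorphism from $H$ to an induced subgraph of $G$; $G$ is $(\alpha,H)$-saturated if there are at least $\alpha|G|^{|H|}$ copies of $H$ in $G$, where $|\cdot|$ denotes the number of vertices. A graph is almost-bipartite if it is triangle-free and its vertex set can be partitioned into a stable set and a set that induces a subgraph of maximum degree at most one. 1. Let $H$ be the four-cycle $C_4$ or its complement $\overline{C_4}$. Then there exists $\varepsilon>0$ such that every $H$-free graph $G$ with $n>1$ vertices contains a complete or anticomplete $(\varepsilon n^{\varepsilon},\varepsilon n)$-pair. 2. More generally, let $H$ be a graph such that both $H$ and its complement $\overline H$ are almost-bipartite. Then there exist $\varepsilon,s>0$ such that for every graph $G$ with $n>1$ vertices and every real $c$ with $0\le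 c\le 1$, either $G$ is $(\varepsilon c^{s},H)$-saturated, or $G$ contains a $c$-sparse or a $(1-c)$-dense $(\varepsilon c^{s}n,\varepsilon n)$-pair. -/

import Mathlib

open scoped Finset

universe u v

namespace SimpleGraph

variable {V : Type v} {W : Type u}

/-- `(A, B)` is an `(x, y)`-pair: disjoint vertex sets with `|A| ≥ x` and `|B| ≥ y`. -/
def IsSizePair (x y : ℝ) (A B : Finset V) : Prop :=
  Disjoint A B ∧ x ≤ (#A : ℝ) ∧ y ≤ (#B : ℝ)

/-- Every vertex of `A` is adjacent to every vertex of `B`, for disjoint `A`, `B`. -/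
def IsCompletePair (G : SimpleGraph V) (A B : Finset V) : Prop :=
  Disjoint A B ∧ ∀ a ∈ A, ∀ b ∈ B, G.Adj a b

/-- There is no edge between `A` and `B`, for disjoint `A`, `B`. -/
def IsAnticompletePair (G : SimpleGraph V) (A B : Finset V) : Prop :=
  Disjoint A B ∧ ∀ a ∈ A, ∀ b ∈ B, ¬ G.Adj a b

open Classical in
/-- The number of edges with one end in `A` and one in `B`. It is used for disjoint `A`, `B`,
where each such edge is exactly one pair `(a, b)` with `a ∈ A`, `b ∈ B`. -/
noncomputable def edgesBetween (G : SimpleGraph V) (A B : Finset V) : ℕ :=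
  #(G.interedges A B)

/-- The pair `(A, B)` is `c`-sparse. -/
def IsSparsePair (G : SimpleGraph V) (c : ℝ) (A B : Finset V) : Prop :=
  Disjoint A B ∧ (G.edgesBetween A B : ℝ) ≤ c * #A * #B

/-- The pair `(A, B)` is `c`-dense. -/
def IsDensePair (G : SimpleGraph V) (c : ℝ) (A B : Finset V) : Prop :=
  Disjoint A B ∧ c * #A * #B ≤ (G.edgesBetween A B : ℝ)

/-- `G` is `(α, H)`-saturated: there are at least `α |G| ^ |H|` copies of `H` in `G`. A copy is an
isomorphism from `H` onto an induced subgraph of `G`, that is, a graph embedding of `H` in `G`. -/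
def IsSaturated (G : SimpleGraph V) (α : ℝ) (H : SimpleGraph W) : Prop :=
  α * (Nat.card V : ℝ) ^ Nat.card W ≤ (Nat.card (H ↪g G) : ℝ)

/-- `H` is triangle-free, and its vertex set is the union of a stable set `S` and a set (the
complement of `S`) that induces a subgraph of maximum degree at most one. -/
def IsAlmostBipartite (H : SimpleGraph W) : Prop :=
  H.CliqueFree 3 ∧ ∃ S : Set W, H.IsIndepSet S ∧
    ∀ v : ↥(Sᶜ), ((H.induce Sᶜ).neighborSet v).encard ≤ 1

/-- There is `ε > 0` such that every finite `H`-free graph (no induced subgraph isomorphic to `H`)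
on `n > 1` vertices contains a complete or anticomplete `(ε n ^ ε, ε n)`-pair. -/
def HasLinearPairProperty (H : SimpleGraph W) : Prop :=
  ∃ ε : ℝ, 0 < ε ∧ ∀ (V : Type v) [Finite V] (G : SimpleGraph V), 1 < Nat.card V →
    ¬ H.IsIndContained G →
    ∃ A B : Finset V,
      IsSizePair (ε * (Nat.card V : ℝ) ^ ε) (ε * (Nat.card V : ℝ)) A B ∧
      (G.IsCompletePair A B ∨ G.IsAnticompletePair A B)

/-- There are `ε, s > 0` such that for every finite graph `G` on `n > 1` vertices and every
`c ∈ [0, 1]`, either `G` is `(ε c ^ s, H)`-saturated, or `G` has a `c`-sparse or `(1 - c)`-dense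
`(ε c ^ s n, ε n)`-pair. -/
def HasSaturationProperty (H : SimpleGraph W) : Prop :=
  ∃ ε s : ℝ, 0 < ε ∧ 0 < s ∧ ∀ (V : Type v) [Finite V] (G : SimpleGraph V), 1 < Nat.card V →
    ∀ c : ℝ, 0 ≤ c → c ≤ 1 →
      G.IsSaturated (ε * c ^ s) H ∨
      ∃ A B : Finset V,
        IsSizePair (ε * c ^ s * (Nat.card V : ℝ)) (ε * (Nat.card V : ℝ)) A B ∧
        (G.IsSparsePair c A B ∨ G.IsDensePair (1 - c) A B)

end SimpleGraph

/-!
A graph `H` such that neither `H` nor its complement contains a triangle has at most five vertices,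
and it is an induced subgraph of `C₅`, of `C₄` or of the complement of `C₄`
(`nonempty_embedding_of_cliqueFree`). Since the saturation property passes to induced subgraphs, it
is enough to prove it for these three graphs.

By Rödl's theorem, in a form that counts copies (`hasHomogeneousSets`), a graph with few copies of
`H` has a set of linear size that has small maximum degree in the graph or in its complement. The
proof is that of Fox and Sudakov: a graph with few copies of `H` has a pair of linear size that is
very sparse or very dense (`exists_sparse_or_dense_pair`), and gluing two sparse sets along a very
sparse pair lowers the density by a constant factor (`HasHomogeneousSets.step`). After passing to
the complement if necessary, let `G` be a graph on `n` vertices of maximum degree at most `n / 40`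
that has no `c`-sparse pair `(A, B)` with `|A| ≥ c ^ 18 * n` and `|B| ≥ n / 40` (`IsExpanding`). It
remains to find polynomially many (in `c`) copies of each of the three graphs, and of their
complements, in `G`.

The central fact is `IsExpanding.sum_card_privateNbr_ge`. For any two sets `K`, `K'` that are not
too small there are many edges `vw` such that `v` has many private neighbours in `K` (neighbours
that are not adjacent to `w`) and `w` has many private neighbours in `K'`.

* If `K = K'` is nearly complete, then the edge `vw` and two private neighbours form a four-cycle.
  For `K` take the common neighbourhood of two non-adjacent vertices `a`, `b`. If it is not nearly
  complete, it contains many non-edges, and each of these forms a four-cycle with `a`, `b`.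
* If there are few edges between `K` and `K'`, then `vw`, two private neighbours and a common
  neighbour of these two form a five-cycle. So if there are few five-cycles, there are many edges
  between any two such sets. Apply this to the sets `N(a) \ (N(b) ∪ N(d))` and
  `N(d) \ (N(a) ∪ N(b))` for an induced path `abd`: each such edge completes the path to a
  five-cycle, and there are many induced paths on three vertices.
* Two disjoint edges with no edge between them are found greedily.

The complete or anticomplete pairs for the four-cycle and its complement follow from the saturation
property with `c = n ^ (-1 / (s + 1))`: a `c`-sparse pair contains an anticomplete pair with
`1 / (2 c)` vertices on one side and half of the other side.
-/

namespace SimpleGraph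

/-! ### Counting edges by real-valued sums -/

section Counting

variable {V : Type v} (G : SimpleGraph V)

open Classical in
/-- The `0`/`1` indicator of adjacency. -/
noncomputable def adjInd (v w : V) : ℝ := if G.Adj v w then 1 else 0

/-- The number of neighbours of `v` in `B`, as a real number. -/
noncomputable def degInto (v : V) (B : Finset V) : ℝ := ∑ b ∈ B, G.adjInd v b

/-- The number of pairs `(a, b)` with `a ∈ A`, `b ∈ B` and `a`, `b` adjacent, as a real number. In
particular `G.edgeSum A A` counts every edge inside `A` twice. -/
noncomputable def edgeSum (A B : Finset V) : ℝ := ∑ a ∈ A, G.degInto a B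

theorem adjInd_nonneg (v w : V) : 0 ≤ G.adjInd v w := by
  unfold adjInd; split_ifs <;> norm_num

theorem adjInd_le_one (v w : V) : G.adjInd v w ≤ 1 := by
  unfold adjInd; split_ifs <;> norm_num

theorem adjInd_comm (v w : V) : G.adjInd v w = G.adjInd w v := by
  by_cases h : G.Adj v w
  · simp [adjInd, h, h.symm]
  · have h' : ¬G.Adj w v := fun h' => h h'.symm
    simp [adjInd, h, h']

theorem degInto_nonneg (v : V) (B : Finset V) : 0 ≤ G.degInto v B :=
  Finset.sum_nonneg fun _ _ => G.adjInd_nonneg _ _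

theorem degInto_le (v : V) (B : Finset V) : G.degInto v B ≤ #B :=
  (Finset.sum_le_sum fun b (_ : b ∈ B) => G.adjInd_le_one v b).trans (by simp)

theorem degInto_mono (v : V) {A B : Finset V} (h : A ⊆ B) : G.degInto v A ≤ G.degInto v B :=
  Finset.sum_le_sum_of_subset_of_nonneg h fun _ _ _ => G.adjInd_nonneg _ _

open Classical in
theorem degInto_eq_card (v : V) (B : Finset V) :
    G.degInto v B = #(B.filter (G.Adj v)) := by
  simp [degInto, adjInd, Finset.sum_boole]

theorem edgeSum_nonneg (A B : Finset V) : 0 ≤ G.edgeSum A B :=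
  Finset.sum_nonneg fun _ _ => G.degInto_nonneg _ _

theorem edgeSum_mono {A A' B B' : Finset V} (hA : A ⊆ A') (hB : B ⊆ B') :
    G.edgeSum A B ≤ G.edgeSum A' B' :=
  (Finset.sum_le_sum fun a _ => G.degInto_mono a hB).trans
    (Finset.sum_le_sum_of_subset_of_nonneg hA fun _ _ _ => G.degInto_nonneg _ _)

theorem edgeSum_comm (A B : Finset V) : G.edgeSum A B = G.edgeSum B A := by
  unfold edgeSum degInto
  rw [Finset.sum_comm]
  simp only [G.adjInd_comm]

theorem edgeSum_eq_edgesBetween (A B : Finset V) : G.edgeSum A B = G.edgesBetween A B := by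
  classical
  have : G.edgesBetween A B = #((A ×ˢ B).filter fun p => G.Adj p.1 p.2) := by
    rw [edgesBetween, interedges_def]
  rw [this, Finset.card_filter, Finset.sum_product]
  push_cast
  simp [edgeSum, degInto, adjInd]

/-- If a function has average at most `l` on `A`, then some subset of `A` of any given smaller size
has that property too: repeatedly delete an element with the largest value. -/
theorem exists_subset_sum_le {A : Finset V} (f : V → ℝ) {l : ℝ} {k : ℕ}
    (hk : k ≤ #A) (h : ∑ a ∈ A, f a ≤ l * #A) :
    ∃ B ⊆ A, #B = k ∧ ∑ a ∈ B, f a ≤ l * k := by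
  classical
  induction hm : #A - k generalizing A with
  | zero =>
    have : #A = k := by omega
    exact ⟨A, subset_rfl, this, by rw [← this]; exact h⟩
  | succ m ih =>
    have hne : A.Nonempty := Finset.card_pos.mp (by omega)
    obtain ⟨x, hx, hmax⟩ := A.exists_max_image f hne
    have hcard : #(A.erase x) = #A - 1 := Finset.card_erase_of_mem hx
    have hApos : (0 : ℝ) < #A := by exact_mod_cast Finset.card_pos.mpr hne
    have hc : ((#(A.erase x) : ℕ) : ℝ) = #A - 1 := by
      rw [hcard, Nat.cast_sub (by omega)]; simp
    have hs : ∑ a ∈ A.erase x, f a = ∑ a ∈ A, f a - f x := by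
      rw [← Finset.add_sum_erase A f hx]; ring
    have hle : ∑ a ∈ A, f a ≤ #A * f x := by
      simpa using Finset.sum_le_card_nsmul A f (f x) hmax
    obtain ⟨B, hB, hBc, hBs⟩ := ih (A := A.erase x) (by omega) (by
      rw [hs, hc]
      by_cases hl : l ≤ f x
      · linarith
      · push Not at hl
        have : (#A - 1 : ℝ) * f x ≤ (#A - 1) * l :=
          mul_le_mul_of_nonneg_left hl.le (by
            have : 1 ≤ #A := Finset.card_pos.mpr hne
            have : (1 : ℝ) ≤ #A := by exact_mod_cast this
            linarith)
        linarith) (by omega)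
    exact ⟨B, hB.trans (Finset.erase_subset _ _), hBc, hBs⟩

theorem edgeSum_erase_self [DecidableEq V] {A : Finset V} {x : V} (hx : x ∈ A) :
    G.edgeSum (A.erase x) (A.erase x) = G.edgeSum A A - 2 * G.degInto x A := by
  have h1 : ∀ a, G.degInto a (A.erase x) = G.degInto a A - G.adjInd a x := fun a => by
    unfold degInto; rw [← Finset.add_sum_erase A _ hx]; ring
  have h2 : ∀ f : V → ℝ, ∑ a ∈ A.erase x, f a = ∑ a ∈ A, f a - f x := fun f => by
    rw [← Finset.add_sum_erase A f hx]; ring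
  have h3 : ∑ a ∈ A, G.adjInd a x = G.degInto x A := by
    simp only [degInto, G.adjInd_comm]
  have h4 : G.adjInd x x = 0 := by simp [adjInd]
  unfold edgeSum
  simp only [h1, Finset.sum_sub_distrib, h2, h3, h4]
  ring

/-- The edge density of a set can be kept while the set is shrunk to any given size: repeatedly
delete a vertex of maximum degree. -/
theorem exists_subset_edgeSum_le {A : Finset V} {l : ℝ} {k : ℕ}
    (hk : k ≤ #A) (h : G.edgeSum A A ≤ l * (#A : ℝ) ^ 2) :
    ∃ B ⊆ A, #B = k ∧ G.edgeSum B B ≤ l * (k : ℝ) ^ 2 := by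
  classical
  induction hm : #A - k generalizing A with
  | zero =>
    have : #A = k := by omega
    exact ⟨A, subset_rfl, this, by rw [← this]; exact h⟩
  | succ m ih =>
    have hne : A.Nonempty := Finset.card_pos.mp (by omega)
    obtain ⟨x, hx, hmax⟩ := A.exists_max_image (fun a => G.degInto a A) hne
    have hcard : #(A.erase x) = #A - 1 := Finset.card_erase_of_mem hx
    have h1 : (1 : ℝ) ≤ #A := by exact_mod_cast Finset.card_pos.mpr hne
    have hc : ((#(A.erase x) : ℕ) : ℝ) = #A - 1 := by
      rw [hcard, Nat.cast_sub (by omega)]; simp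
    have hle : G.edgeSum A A ≤ #A * G.degInto x A := by
      simpa [edgeSum] using Finset.sum_le_card_nsmul A (fun a => G.degInto a A) _ hmax
    have hl : 0 ≤ l := by
      by_contra hl
      push Not at hl
      have := G.edgeSum_nonneg A A
      nlinarith [sq_pos_of_pos (lt_of_lt_of_le one_pos h1)]
    obtain ⟨B, hB, hBc, hBs⟩ := ih (A := A.erase x) (by omega) (by
      rw [G.edgeSum_erase_self hx, hc]
      set m : ℝ := (#A : ℝ)
      set d := G.degInto x A
      set E := G.edgeSum A A
      -- `m (E - 2 d) ≤ (m - 2) E`, and `m (m - 1) ^ 2 ≥ (m - 2) m ^ 2`.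
      by_cases hd : l * m ≤ d
      · nlinarith
      · push Not at hd
        by_cases h2 : 2 ≤ m
        · have hE : m * (E - 2 * d) ≤ (m - 2) * E := by nlinarith
          have hE2 : (m - 2) * E ≤ (m - 2) * (l * m ^ 2) :=
            mul_le_mul_of_nonneg_left h (by linarith)
          have : m * (E - 2 * d) ≤ m * (l * (m - 1) ^ 2) := by nlinarith
          exact le_of_mul_le_mul_left this (by linarith)
        · have hm1 : #A = 1 := by
            have : (#A : ℝ) < 2 := not_le.mp h2
            have : #A < 2 := by exact_mod_cast this
            have := Finset.card_pos.mpr hne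
            omega
          obtain ⟨y, hy⟩ := Finset.card_eq_one.mp hm1
          have : E = 0 := by simp [E, hy, edgeSum, degInto, adjInd]
          have hd0 := G.degInto_nonneg x A
          nlinarith [sq_nonneg (m - 1)]) (by omega)
    exact ⟨B, hB.trans (Finset.erase_subset _ _), hBc, hBs⟩

end Counting

/-! ### Embedding a graph into blocks without sparse or dense pairs -/

section Blocks

variable {V : Type v}

/-- `U` contains no pair `(A, B)` with both sides of size at least `μ` in which every vertex of `A`
has fewer than `η|B|` neighbours in `B`, or every vertex of `A` has fewer than `η|B|`
non-neighbours in `B`. -/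
def IsMixed (G : SimpleGraph V) (η μ : ℝ) (U : Finset V) : Prop :=
  ∀ A ⊆ U, ∀ B ⊆ U, Disjoint A B → μ ≤ #A → μ ≤ #B →
    (∃ a ∈ A, η * #B ≤ G.degInto a B) ∧ (∃ a ∈ A, η * #B ≤ Gᶜ.degInto a B)

open Classical in
/-- The copies of `H` in `G` whose `i`-th vertex lies in `B i` (for disjoint sets `B i`). -/
noncomputable def transversalCopies [Fintype V] (G : SimpleGraph V) {h : ℕ}
    (H : SimpleGraph (Fin h)) (B : Fin h → Finset V) : Finset (Fin h → V) :=
  Finset.univ.filter fun f => (∀ i, f i ∈ B i) ∧ ∀ i j, i < j → (G.Adj (f i) (f j) ↔ H.Adj i j)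

theorem exists_transversalCopies_ge {h : ℕ} (H : SimpleGraph (Fin h)) {η : ℝ} (hη : 0 < η) :
    ∃ γ : ℝ, 0 < γ ∧ ∀ (V : Type v) [Fintype V] (G : SimpleGraph V) (μ t : ℝ) (U : Finset V)
      (B : Fin h → Finset V), 0 < t → μ ≤ γ * t → (∀ i j, i ≠ j → Disjoint (B i) (B j)) →
      (∀ i, B i ⊆ U) → (∀ i, t ≤ #(B i)) → G.IsMixed η μ U →
      γ * t ^ h ≤ #(G.transversalCopies H B) := by
  classical
  induction h with
  | zero =>
    refine ⟨1, one_pos, fun V _ G μ t U B _ _ _ _ _ _ => ?_⟩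
    simp [transversalCopies]
  | succ h ih =>
    obtain ⟨γ, hγ, hcount⟩ := ih (H.comap Fin.succ)
    refine ⟨min (γ * η) (min (γ * η ^ h / 2) (1 / (2 * (h + 1)))), by positivity,
      fun V _ G μ t U B ht hμ hdisj hBU hBt hmix => ?_⟩
    set γ' := min (γ * η) (min (γ * η ^ h / 2) (1 / (2 * (h + 1)))) with hγ'
    have hg1 : γ' ≤ γ * η := min_le_left _ _
    have hg2 : γ' ≤ γ * η ^ h / 2 := (min_le_right _ _).trans (min_le_left _ _)
    have hg3 : γ' ≤ 1 / (2 * (h + 1)) := (min_le_right _ _).trans (min_le_right _ _)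
    have hμ3 : μ ≤ 1 / (2 * (h + 1)) * t := hμ.trans (mul_le_mul_of_nonneg_right hg3 ht.le)
    have hμt : μ ≤ t := by
      refine hμ3.trans ?_
      have : (1 : ℝ) / (2 * (h + 1)) ≤ 1 := by
        rw [div_le_one (by positivity)]
        have : (0 : ℝ) ≤ h := by positivity
        linarith
      nlinarith
    -- `K j` is `G` or its complement, according to the adjacency wanted between `0` and `j + 1`.
    set K : Fin h → SimpleGraph V := fun j => if H.Adj 0 j.succ then G else Gᶜ with hK
    have hKadj : ∀ j v b, (K j).Adj v b → (G.Adj v b ↔ H.Adj 0 j.succ) := by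
      intro j v b hb
      by_cases hj : H.Adj 0 j.succ
      · simp only [hK, hj, if_true] at hb
        simp [hb, hj]
      · simp only [hK, hj, if_false, compl_adj] at hb
        simp [hb.2, hj]
    set bad : Fin h → Finset V := fun j =>
      (B 0).filter fun v => (K j).degInto v (B j.succ) < η * #(B j.succ) with hbad
    have hbadlt : ∀ j, (#(bad j) : ℝ) ≤ μ := by
      intro j
      by_contra hlt
      push Not at hlt
      have hm := hmix (bad j) ((Finset.filter_subset _ _).trans (hBU 0)) (B j.succ) (hBU _)
        (Disjoint.mono_left (Finset.filter_subset _ _) (hdisj _ _ (Fin.succ_ne_zero j).symm))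
        hlt.le (hμt.trans (hBt _))
      have : ∃ a ∈ bad j, η * #(B j.succ) ≤ (K j).degInto a (B j.succ) := by
        by_cases hj : H.Adj 0 j.succ
        · simp only [hK, hj, if_true]; exact hm.1
        · simp only [hK, hj, if_false]; exact hm.2
      obtain ⟨a, ha, hle⟩ := this
      exact absurd (Finset.mem_filter.mp ha).2 (not_lt.mpr hle)
    set good := B 0 \ Finset.univ.biUnion bad with hgood
    have hgoodcard : t / 2 ≤ #good := by
      have h1 : (#(Finset.univ.biUnion bad) : ℝ) ≤ h * μ := by
        calc (#(Finset.univ.biUnion bad) : ℝ) ≤ ∑ j, (#(bad j) : ℝ) := by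
              exact_mod_cast Finset.card_biUnion_le
          _ ≤ ∑ j : Fin h, μ := Finset.sum_le_sum fun j _ => hbadlt j
          _ = h * μ := by simp
      have h2 : (h : ℝ) * μ ≤ t / 2 := by
        have : (h : ℝ) * μ ≤ h * (1 / (2 * (h + 1)) * t) := by gcongr
        refine this.trans ?_
        rw [div_mul_eq_mul_div, one_mul, mul_div_assoc', div_le_div_iff₀ (by positivity) two_pos]
        nlinarith
      have h3 : (#(B 0) : ℝ) ≤ #good + #(Finset.univ.biUnion bad) := by
        exact_mod_cast (Nat.sub_le_iff_le_add.mp (Finset.le_card_sdiff _ _))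
      have := hBt 0
      linarith
    set B' : V → Fin h → Finset V := fun v j => (B j.succ).filter ((K j).Adj v) with hB'
    have hrec : ∀ v ∈ good, γ * (η * t) ^ h ≤
        #(G.transversalCopies (H.comap Fin.succ) (B' v)) := by
      intro v hv
      refine hcount V G μ (η * t) U (B' v) (by positivity) ?_ ?_ ?_ ?_ hmix
      · calc μ ≤ γ' * t := hμ
          _ ≤ γ * η * t := by gcongr
          _ = _ := by ring
      · intro i j hij
        exact Disjoint.mono (Finset.filter_subset _ _) (Finset.filter_subset _ _)
          (hdisj _ _ (fun hh => hij (Fin.succ_injective _ hh)))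
      · exact fun i => (Finset.filter_subset _ _).trans (hBU _)
      · intro j
        have hvj : v ∉ bad j := fun hh =>
          (Finset.mem_sdiff.mp hv).2 (Finset.mem_biUnion.mpr ⟨j, Finset.mem_univ _, hh⟩)
        have : η * #(B j.succ) ≤ (K j).degInto v (B j.succ) := by
          by_contra hh
          exact hvj (Finset.mem_filter.mpr ⟨(Finset.mem_sdiff.mp hv).1, not_le.mp hh⟩)
        rw [degInto_eq_card] at this
        exact (mul_le_mul_of_nonneg_left (hBt _) hη.le).trans this
    have hinj : #(good.sigma fun v => G.transversalCopies (H.comap Fin.succ) (B' v)) ≤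
        #(G.transversalCopies H B) := by
      refine Finset.card_le_card_of_injOn (fun p => Fin.cons p.1 p.2) ?_ ?_
      · rintro ⟨v, f⟩ hp
        obtain ⟨hv, hf⟩ := Finset.mem_sigma.mp hp
        obtain ⟨-, hf1, hf2⟩ := Finset.mem_filter.mp hf
        refine Finset.mem_coe.mpr (Finset.mem_filter.mpr ⟨Finset.mem_univ _, ?_, ?_⟩)
        · intro i
          refine Fin.cases ?_ (fun j => ?_) i
          · exact (Finset.mem_sdiff.mp hv).1
          · exact (Finset.mem_filter.mp (hf1 j)).1
        · intro i j
          refine Fin.cases ?_ (fun i => ?_) i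
          · refine Fin.cases (fun hh => absurd hh (lt_irrefl _)) (fun j _ => ?_) j
            simpa using hKadj j v (f j) (Finset.mem_filter.mp (hf1 j)).2
          · refine Fin.cases (fun hh => absurd hh (by simp)) (fun j hij => ?_) j
            simpa using hf2 i j (Fin.succ_lt_succ_iff.mp hij)
      · rintro ⟨v, f⟩ _ ⟨w, g⟩ _ hvw
        obtain ⟨h1, h2⟩ := Fin.cons_inj.mp hvw
        simp only at h1 h2
        simp [h1, h2]
    rw [Finset.card_sigma] at hinj
    calc γ' * t ^ (h + 1) ≤ γ * η ^ h / 2 * t ^ (h + 1) := by gcongr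
      _ = t / 2 * (γ * (η * t) ^ h) := by rw [mul_pow]; ring
      _ ≤ #good * (γ * (η * t) ^ h) := by gcongr
      _ = ∑ v ∈ good, γ * (η * t) ^ h := by simp
      _ ≤ ∑ v ∈ good, (#(G.transversalCopies (H.comap Fin.succ) (B' v)) : ℝ) :=
        Finset.sum_le_sum hrec
      _ ≤ _ := by exact_mod_cast hinj

/-- Inside any set there are `h` disjoint sets of size `k`, as long as there is room for them. -/
theorem exists_disjoint_blocks (U : Finset V) (h k : ℕ) (hU : h * k ≤ #U) :
    ∃ B : Fin h → Finset V, (∀ i j, i ≠ j → Disjoint (B i) (B j)) ∧ (∀ i, B i ⊆ U) ∧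
      ∀ i, #(B i) = k := by
  classical
  induction h generalizing U with
  | zero => exact ⟨fun _ => ∅, fun i => i.elim0, fun i => i.elim0, fun i => i.elim0⟩
  | succ h ih =>
    obtain ⟨A, hA, hAk⟩ := Finset.exists_subset_card_eq (s := U) (n := k) (by nlinarith)
    obtain ⟨B, h1, h2, h3⟩ := ih (U \ A) (by
      rw [Finset.card_sdiff_of_subset hA, hAk]
      have : (h + 1) * k = h * k + k := by ring
      omega)
    have hAB : ∀ j, Disjoint A (B j) := fun j =>
      (Finset.disjoint_sdiff).mono_right (h2 j)
    refine ⟨Fin.cons A B, ?_, ?_, ?_⟩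
    · intro i j
      refine Fin.cases ?_ (fun i => ?_) i <;> refine Fin.cases ?_ (fun j => ?_) j
      · simp
      · intro _; simpa using hAB j
      · intro _; simpa using (hAB i).symm
      · intro hij; simpa using h1 i j (fun hh => hij (by rw [hh]))
    · intro i
      refine Fin.cases hA (fun i => ?_) i
      simpa using (h2 i).trans Finset.sdiff_subset
    · intro i
      refine Fin.cases hAk (fun i => ?_) i
      simpa using h3 i

theorem card_transversalCopies_le [Fintype V] (G : SimpleGraph V) {h : ℕ} (H : SimpleGraph (Fin h))
    (B : Fin h → Finset V) (hB : ∀ i j, i ≠ j → Disjoint (B i) (B j)) :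
    #(G.transversalCopies H B) ≤ Nat.card (H ↪g G) := by
  classical
  have : Finite (H ↪g G) := Finite.of_injective (fun f => (f : Fin h → V)) DFunLike.coe_injective
  have key : ∀ f ∈ G.transversalCopies H B, ∃ e : H ↪g G, (e : Fin h → V) = f := by
    intro f hf
    obtain ⟨-, h1, h2⟩ := Finset.mem_filter.mp hf
    refine ⟨⟨⟨f, fun i j hij => ?_⟩, fun {i j} => ?_⟩, rfl⟩
    · by_contra hne
      exact Finset.disjoint_left.mp (hB i j hne) (h1 i) (by rw [hij]; exact h1 j)
    · rcases lt_trichotomy i j with hij | rfl | hij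
      · exact h2 i j hij
      · simp
      · rw [G.adj_comm, H.adj_comm]; exact h2 j i hij
  choose e he using key
  have hinj := Nat.card_le_card_of_injective
    (fun f : {f // f ∈ G.transversalCopies H B} => e f.1 f.2) fun f g hfg => by
      have := congrArg (fun e : H ↪g G => (e : Fin h → V)) hfg
      simp only [he f.1 f.2, he g.1 g.2] at this
      exact Subtype.ext this
  simpa using hinj

/-- A set in which `G` has few copies of `H` contains a pair of linear size that is very sparse or
very dense. -/
theorem exists_sparse_or_dense_pair {h : ℕ} (H : SimpleGraph (Fin h)) {η : ℝ} (hη : 0 < η) :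
    ∃ δ : ℝ, 0 < δ ∧ ∀ (V : Type v) [Fintype V] (G : SimpleGraph V) (U : Finset V),
      h + 1 ≤ #U → (Nat.card (H ↪g G) : ℝ) < δ * (#U : ℝ) ^ h →
      ∃ A ⊆ U, ∃ B ⊆ U, Disjoint A B ∧ δ * #U ≤ #A ∧ δ * #U ≤ #B ∧
        ((∀ a ∈ A, G.degInto a B ≤ η * #B) ∨ (∀ a ∈ A, Gᶜ.degInto a B ≤ η * #B)) := by
  obtain ⟨γ, hγ, hcount⟩ := exists_transversalCopies_ge.{v} H hη
  set θ : ℝ := 1 / (2 * (h + 1)) with hθ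
  have hθ0 : 0 < θ := by positivity
  refine ⟨min (γ * θ) (γ * θ ^ h), by positivity, fun V _ G U hU hfew => ?_⟩
  set δ := min (γ * θ) (γ * θ ^ h)
  have hUpos : (0 : ℝ) < #U := by exact_mod_cast (by omega : 0 < #U)
  obtain ⟨B, hB1, hB2, hB3⟩ := exists_disjoint_blocks U h (#U / (h + 1))
    ((Nat.mul_le_mul_right _ (Nat.le_succ h)).trans (Nat.mul_div_le _ _))
  by_contra hno
  have hmix : G.IsMixed η (δ * #U) U := by
    intro A hA C hC hAC h1 h2
    constructor
    · by_contra hh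
      push Not at hh
      exact hno ⟨A, hA, C, hC, hAC, h1, h2, Or.inl fun a ha => (hh a ha).le⟩
    · by_contra hh
      push Not at hh
      exact hno ⟨A, hA, C, hC, hAC, h1, h2, Or.inr fun a ha => (hh a ha).le⟩
  have hsize : θ * #U ≤ ((#U / (h + 1) : ℕ) : ℝ) := by
    have h1 : #U < (h + 1) * (#U / (h + 1) + 1) := Nat.lt_mul_div_succ _ (by omega)
    have h2 : 1 ≤ #U / (h + 1) := (Nat.one_le_div_iff (by omega)).mpr hU
    have h3 : (#U : ℝ) ≤ (h + 1) * (2 * ((#U / (h + 1) : ℕ) : ℝ)) := by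
      have : #U ≤ (h + 1) * (2 * (#U / (h + 1))) := by nlinarith
      exact_mod_cast this
    rw [hθ, div_mul_eq_mul_div, one_mul, div_le_iff₀ (by positivity)]
    linarith
  have h1 := hcount V G (δ * #U) (θ * #U) U B (by positivity) (by
    calc δ * #U ≤ γ * θ * #U := by gcongr; exact min_le_left _ _
      _ = _ := by ring) hB1 hB2 (fun i => by rw [hB3]; exact hsize) hmix
  have h2 : (#(G.transversalCopies H B) : ℝ) ≤ Nat.card (H ↪g G) := by
    exact_mod_cast card_transversalCopies_le G H B hB1
  have h3 : δ * (#U : ℝ) ^ h ≤ γ * (θ * #U) ^ h := by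
    rw [mul_pow, ← mul_assoc]; gcongr; exact min_le_right _ _
  linarith

end Blocks

/-! ### Sparse or dense sets of linear size -/

section Homogeneous

variable {V : Type v}

theorem edgeSum_union_self [DecidableEq V] (G : SimpleGraph V) {X Y : Finset V}
    (h : Disjoint X Y) :
    G.edgeSum (X ∪ Y) (X ∪ Y) = G.edgeSum X X + G.edgeSum Y Y + 2 * G.edgeSum Y X := by
  have h1 : ∀ v, G.degInto v (X ∪ Y) = G.degInto v X + G.degInto v Y :=
    fun v => Finset.sum_union h
  have h2 := G.edgeSum_comm X Y
  have h3 : ∑ x ∈ X, G.degInto x Y = ∑ y ∈ Y, G.degInto y X := h2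
  unfold edgeSum
  simp only [h1, Finset.sum_union h, Finset.sum_add_distrib, h3]
  ring

/-- One round of density reduction: two sparse sets of density `3α/2` with almost no edges between
them have a union of density at most `α`. The alternative `P` is carried along. -/
theorem exists_sparser_subset (G : SimpleGraph V) {α : ℝ} (hα : 0 < α) (P : Finset V → Prop)
    [DecidableEq V] {A B : Finset V} (hAB : Disjoint A B) {k : ℕ}
    (hsparse : ∀ a ∈ A, G.degInto a B ≤ α / 4 * #B)
    (hA : ∃ X ⊆ A, #X = k ∧ (G.edgeSum X X ≤ 3 / 2 * α * (k : ℝ) ^ 2 ∨ P X))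
    (hB : ∀ C ⊆ B, (#B : ℝ) / 2 ≤ #C →
      ∃ Y ⊆ C, #Y = k ∧ (G.edgeSum Y Y ≤ 3 / 2 * α * (k : ℝ) ^ 2 ∨ P Y)) :
    ∃ X ⊆ A ∪ B, #X = k ∧ (G.edgeSum X X ≤ α * (k : ℝ) ^ 2 ∨ P X) := by
  classical
  obtain ⟨X, hXA, hXk, hX | hX⟩ := hA
  swap
  · exact ⟨X, hXA.trans Finset.subset_union_left, hXk, Or.inr hX⟩
  rcases Nat.eq_zero_or_pos k with rfl | hk
  · refine ⟨∅, Finset.empty_subset _, rfl, Or.inl ?_⟩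
    simp [edgeSum]
  set j := (k + 1) / 2 with hj
  have hj0 : (0 : ℝ) < j := by exact_mod_cast (by omega : 0 < j)
  obtain ⟨X', hX'X, hX'j, hX'⟩ := G.exists_subset_edgeSum_le (A := X) (k := j) (by omega)
    (by rw [hXk]; exact hX)
  set C := B.filter fun b => G.degInto b X' ≤ α / 2 * j with hC
  have hCcard : (#B : ℝ) / 2 ≤ #C := by
    have h1 : G.edgeSum X' B ≤ j * (α / 4 * #B) := by
      calc G.edgeSum X' B ≤ ∑ a ∈ X', α / 4 * (#B : ℝ) :=
            Finset.sum_le_sum fun a ha => hsparse a (hXA (hX'X ha))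
        _ = _ := by simp [hX'j]
    have h2 : (#(B.filter fun b => ¬ G.degInto b X' ≤ α / 2 * j) : ℝ) * (α / 2 * j) ≤
        G.edgeSum B X' := by
      calc _ = ∑ b ∈ B.filter (fun b => ¬ G.degInto b X' ≤ α / 2 * j), α / 2 * (j : ℝ) := by
            simp
        _ ≤ ∑ b ∈ B.filter (fun b => ¬ G.degInto b X' ≤ α / 2 * j), G.degInto b X' :=
            Finset.sum_le_sum fun b hb => (not_le.mp (Finset.mem_filter.mp hb).2).le
        _ ≤ _ := G.edgeSum_mono (Finset.filter_subset _ _) subset_rfl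
    rw [G.edgeSum_comm] at h2
    have h3 : (#C : ℝ) + #(B.filter fun b => ¬ G.degInto b X' ≤ α / 2 * j) = #B := by
      exact_mod_cast Finset.card_filter_add_card_filter_not
        (fun b => G.degInto b X' ≤ α / 2 * j)
    set D : ℝ := (#(B.filter fun b => ¬ G.degInto b X' ≤ α / 2 * j) : ℝ)
    have h4 : D * (α / 2 * j) ≤ (#B / 2) * (α / 2 * j) := by linarith
    have h5 := le_of_mul_le_mul_right h4 (by positivity)
    linarith
  obtain ⟨Y, hYC, hYk, hY | hY⟩ := hB C (Finset.filter_subset _ _) hCcard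
  swap
  · exact ⟨Y, (hYC.trans (Finset.filter_subset _ _)).trans Finset.subset_union_right, hYk,
      Or.inr hY⟩
  obtain ⟨Y', hY'Y, hY'j, hY'⟩ := G.exists_subset_edgeSum_le (A := Y) (k := j) (by omega)
    (by rw [hYk]; exact hY)
  have hX'A := hX'X.trans hXA
  have hY'B := (hY'Y.trans hYC).trans (Finset.filter_subset _ _)
  have hdisj : Disjoint X' Y' := Disjoint.mono hX'A hY'B hAB
  have hcross : G.edgeSum Y' X' ≤ j * (α / 2 * j) := by
    calc G.edgeSum Y' X' ≤ ∑ a ∈ Y', α / 2 * (j : ℝ) :=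
          Finset.sum_le_sum fun a ha => (Finset.mem_filter.mp (hYC (hY'Y ha))).2
      _ = _ := by simp [hY'j]
  have hcard : #(X' ∪ Y') = 2 * j := by
    rw [Finset.card_union_of_disjoint hdisj]; omega
  obtain ⟨Z, hZ, hZk, hZe⟩ := G.exists_subset_edgeSum_le (A := X' ∪ Y') (l := α) (k := k)
    (by omega) (by
      rw [edgeSum_union_self G hdisj, hcard]
      push_cast
      nlinarith)
  exact ⟨Z, hZ.trans (Finset.union_subset_union hX'A hY'B), hZk, Or.inl hZe⟩

/-- If `G` has few copies of `H` relative to the size of a set `U`, then `U` contains a set of any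
prescribed size up to a constant proportion of `U` with density at most `α` in `G` or at most `β`
in the complement of `G`. -/
def HasHomogeneousSets {h : ℕ} (H : SimpleGraph (Fin h)) (α β : ℝ) : Prop :=
  ∃ δ : ℝ, 0 < δ ∧ ∀ (V : Type v) [Fintype V] (G : SimpleGraph V) (U : Finset V) (k : ℕ),
    (Nat.card (H ↪g G) : ℝ) < δ * (#U : ℝ) ^ h → k ≤ δ * #U →
    ∃ X ⊆ U, #X = k ∧
      (G.edgeSum X X ≤ α * (k : ℝ) ^ 2 ∨ Gᶜ.edgeSum X X ≤ β * (k : ℝ) ^ 2)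

theorem edgeSum_self_le (G : SimpleGraph V) (X : Finset V) :
    G.edgeSum X X ≤ (#X : ℝ) ^ 2 := by
  calc G.edgeSum X X ≤ ∑ a ∈ X, (#X : ℝ) := Finset.sum_le_sum fun a _ => G.degInto_le a X
    _ = _ := by simp [sq]

theorem hasHomogeneousSets_of_one_le {h : ℕ} (H : SimpleGraph (Fin h)) {α β : ℝ}
    (hαβ : 1 ≤ α ∨ 1 ≤ β) : HasHomogeneousSets.{v} H α β := by
  refine ⟨1, one_pos, fun V _ G U k _ hk => ?_⟩
  obtain ⟨X, hX, hXk⟩ := Finset.exists_subset_card_eq (s := U) (n := k)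
    (by rw [one_mul] at hk; exact_mod_cast hk)
  refine ⟨X, hX, hXk, hαβ.imp (fun h1 => ?_) (fun h1 => ?_)⟩
  · have := G.edgeSum_self_le X
    rw [hXk] at this
    nlinarith [sq_nonneg (k : ℝ)]
  · have := Gᶜ.edgeSum_self_le X
    rw [hXk] at this
    nlinarith [sq_nonneg (k : ℝ)]

theorem HasHomogeneousSets.step {h : ℕ} {H : SimpleGraph (Fin h)} {α β : ℝ} (hα : 0 < α)
    (hβ : 0 < β) (h1 : HasHomogeneousSets.{v} H (3 / 2 * α) β)
    (h2 : HasHomogeneousSets.{v} H α (3 / 2 * β)) : HasHomogeneousSets.{v} H α β := by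
  classical
  obtain ⟨δ₁, hδ₁, h1⟩ := h1
  obtain ⟨δ₂, hδ₂, h2⟩ := h2
  obtain ⟨δ₀, hδ₀, h0⟩ := exists_sparse_or_dense_pair.{v} H (η := min α β / 4) (by positivity)
  set m := min δ₁ δ₂ with hm
  have hm0 : 0 < m := lt_min hδ₁ hδ₂
  set δ := min (min δ₀ (1 / (h + 1))) (min (m * (δ₀ / 2) ^ h) (m * (δ₀ / 2))) with hδ
  have hd0 : δ ≤ δ₀ := (min_le_left _ _).trans (min_le_left _ _)
  have hdh : δ ≤ 1 / (h + 1) := (min_le_left _ _).trans (min_le_right _ _)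
  have hd1 : δ ≤ m * (δ₀ / 2) ^ h := (min_le_right _ _).trans (min_le_left _ _)
  have hd2 : δ ≤ m * (δ₀ / 2) := (min_le_right _ _).trans (min_le_right _ _)
  refine ⟨δ, by positivity, fun V _ G U k hfew hk => ?_⟩
  rcases Nat.eq_zero_or_pos k with rfl | hk0
  · exact ⟨∅, Finset.empty_subset _, rfl, Or.inl (by simp [edgeSum])⟩
  have hUh : h + 1 ≤ #U := by
    have hk1 : (1 : ℝ) ≤ k := by exact_mod_cast hk0
    have : (1 : ℝ) ≤ 1 / (h + 1) * #U := by
      refine (hk1.trans hk).trans ?_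
      gcongr
    rw [div_mul_eq_mul_div, one_mul, le_div_iff₀ (by positivity), one_mul] at this
    exact_mod_cast this
  have hU0 : (0 : ℝ) < #U := by exact_mod_cast (by omega : 0 < #U)
  obtain ⟨A, hAU, B, hBU, hAB, hA, hB, hpair⟩ := h0 V G U hUh
    (hfew.trans_le (by gcongr))
  -- Both induction hypotheses apply to every set of size at least `δ₀ / 2 * |U|`.
  have hlarge : ∀ C : Finset V, δ₀ / 2 * #U ≤ #C →
      (Nat.card (H ↪g G) : ℝ) < m * (#C : ℝ) ^ h ∧ k ≤ m * #C := by
    intro C hC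
    constructor
    · calc (Nat.card (H ↪g G) : ℝ) < δ * (#U : ℝ) ^ h := hfew
        _ ≤ m * (δ₀ / 2) ^ h * (#U : ℝ) ^ h := by gcongr
        _ = m * (δ₀ / 2 * #U) ^ h := by rw [mul_pow]; ring
        _ ≤ _ := by gcongr
    · calc (k : ℝ) ≤ δ * #U := hk
        _ ≤ m * (δ₀ / 2) * #U := by gcongr
        _ = m * (δ₀ / 2 * #U) := by ring
        _ ≤ _ := by gcongr
  have hφ1 : ∀ C : Finset V, δ₀ / 2 * #U ≤ #C → ∃ X ⊆ C, #X = k ∧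
      (G.edgeSum X X ≤ 3 / 2 * α * (k : ℝ) ^ 2 ∨ Gᶜ.edgeSum X X ≤ β * (k : ℝ) ^ 2) :=
    fun C hC => h1 V G C k ((hlarge C hC).1.trans_le (by gcongr; exact min_le_left _ _))
      ((hlarge C hC).2.trans (by gcongr; exact min_le_left _ _))
  have hφ2 : ∀ C : Finset V, δ₀ / 2 * #U ≤ #C → ∃ X ⊆ C, #X = k ∧
      (G.edgeSum X X ≤ α * (k : ℝ) ^ 2 ∨ Gᶜ.edgeSum X X ≤ 3 / 2 * β * (k : ℝ) ^ 2) :=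
    fun C hC => h2 V G C k ((hlarge C hC).1.trans_le (by gcongr; exact min_le_right _ _))
      ((hlarge C hC).2.trans (by gcongr; exact min_le_right _ _))
  have hAlarge : δ₀ / 2 * #U ≤ #A := by nlinarith
  have hBlarge : ∀ C : Finset V, (#B : ℝ) / 2 ≤ #C → δ₀ / 2 * #U ≤ #C := fun C hC => by nlinarith
  have hAB' : A ∪ B ⊆ U := Finset.union_subset hAU hBU
  rcases hpair with hs | hs
  · obtain ⟨X, hX, hXk, hXP⟩ := G.exists_sparser_subset hα
      (fun X => Gᶜ.edgeSum X X ≤ β * (k : ℝ) ^ 2) hAB (k := k)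
      (fun a ha => (hs a ha).trans (by gcongr; exact min_le_left _ _)) (hφ1 A hAlarge)
      (fun C _ hC => hφ1 C (hBlarge C hC))
    exact ⟨X, hX.trans hAB', hXk, hXP⟩
  · obtain ⟨X, hX, hXk, hXP⟩ := Gᶜ.exists_sparser_subset hβ
      (fun X => G.edgeSum X X ≤ α * (k : ℝ) ^ 2) hAB (k := k)
      (fun a ha => (hs a ha).trans (by gcongr; exact min_le_right _ _))
      (by simpa only [or_comm] using hφ2 A hAlarge)
      (fun C _ hC => by simpa only [or_comm] using hφ2 C (hBlarge C hC))
    exact ⟨X, hX.trans hAB', hXk, hXP.symm⟩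

/-- Rödl's theorem: induct on the number of factors `3/2` missing from `α * β`. -/
theorem hasHomogeneousSets {h : ℕ} (H : SimpleGraph (Fin h)) {α β : ℝ} (hα : 0 < α)
    (hβ : 0 < β) : HasHomogeneousSets.{v} H α β := by
  obtain ⟨N, hN⟩ := pow_unbounded_of_one_lt (1 / (α * β)) (by norm_num : (1 : ℝ) < 3 / 2)
  rw [div_lt_iff₀ (by positivity)] at hN
  induction N generalizing α β with
  | zero =>
    apply hasHomogeneousSets_of_one_le
    by_contra hh
    push Not at hh
    nlinarith [hh.1, hh.2]
  | succ N ih =>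
    rw [pow_succ] at hN
    exact HasHomogeneousSets.step hα hβ
      (ih (by positivity) hβ (hN.trans_eq (by ring)))
      (ih hα (by positivity) (hN.trans_eq (by ring)))

/-- The vertices of low degree in a sparse set induce a subgraph of small maximum degree. -/
theorem exists_subset_degInto_le (G : SimpleGraph V) {α : ℝ} {X : Finset V}
    (hα : 0 < α) (hX : G.edgeSum X X ≤ α * (#X : ℝ) ^ 2) :
    ∃ Y ⊆ X, (#X : ℝ) / 2 ≤ #Y ∧ ∀ y ∈ Y, G.degInto y Y ≤ 4 * α * #Y := by
  classical
  set Y := X.filter fun x => G.degInto x X ≤ 2 * α * #X with hY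
  have hcard : (#X : ℝ) / 2 ≤ #Y := by
    rcases X.eq_empty_or_nonempty with rfl | hne
    · simp
    have hX0 : (0 : ℝ) < #X := by exact_mod_cast hne.card_pos
    have h2 : (#(X.filter fun x => ¬ G.degInto x X ≤ 2 * α * #X) : ℝ) * (2 * α * #X) ≤
        G.edgeSum X X := by
      calc _ = ∑ b ∈ X.filter (fun x => ¬ G.degInto x X ≤ 2 * α * #X), 2 * α * (#X : ℝ) := by
            simp
        _ ≤ ∑ b ∈ X.filter (fun x => ¬ G.degInto x X ≤ 2 * α * #X), G.degInto b X :=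
            Finset.sum_le_sum fun b hb => (not_le.mp (Finset.mem_filter.mp hb).2).le
        _ ≤ _ := G.edgeSum_mono (Finset.filter_subset _ _) subset_rfl
    have h3 : (#Y : ℝ) + #(X.filter fun x => ¬ G.degInto x X ≤ 2 * α * #X) = #X := by
      exact_mod_cast Finset.card_filter_add_card_filter_not
        (fun x => G.degInto x X ≤ 2 * α * #X)
    set D : ℝ := (#(X.filter fun x => ¬ G.degInto x X ≤ 2 * α * #X) : ℝ)
    have h4 : D * (2 * α * #X) ≤ (#X / 2) * (2 * α * #X) := by nlinarith
    have h5 := le_of_mul_le_mul_right h4 (by positivity)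
    linarith
  refine ⟨Y, Finset.filter_subset _ _, hcard, fun y hy => ?_⟩
  have h1 := (Finset.mem_filter.mp hy).2
  have h2 := G.degInto_mono y (Finset.filter_subset (fun x => G.degInto x X ≤ 2 * α * #X) X)
  calc G.degInto y Y ≤ 2 * α * #X := h2.trans h1
    _ ≤ 2 * α * (2 * #Y) := by gcongr; linarith
    _ = _ := by ring

end Homogeneous

/-! ### Counting induced copies -/

section Copies

variable {V : Type v} (G : SimpleGraph V)

open Classical in
/-- The indicator of the tuples `f` that are copies of `H` in `G`. -/
noncomputable def copyInd {h : ℕ} (H : SimpleGraph (Fin h)) (f : Fin h → V) : ℝ :=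
  if ∃ e : H ↪g G, (e : Fin h → V) = f then 1 else 0

theorem copyInd_nonneg {h : ℕ} (H : SimpleGraph (Fin h)) (f : Fin h → V) :
    0 ≤ G.copyInd H f := by
  unfold copyInd; split_ifs <;> norm_num

theorem sum_copyInd_le [Fintype V] {h : ℕ} (H : SimpleGraph (Fin h)) {α : Type*} [Fintype α]
    (t : α → Fin h → V) (ht : Function.Injective t) :
    ∑ p, G.copyInd H (t p) ≤ Nat.card (H ↪g G) := by
  classical
  have : Finite (H ↪g G) := Finite.of_injective (fun f => (f : Fin h → V)) DFunLike.coe_injective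
  have h1 : ∑ p, G.copyInd H (t p) =
      #(Finset.univ.filter fun p => ∃ e : H ↪g G, (e : Fin h → V) = t p) := by
    rw [Finset.card_filter]
    push_cast
    refine Finset.sum_congr rfl fun p _ => ?_
    unfold copyInd
    congr
  rw [h1]
  have key : ∀ p : {p // p ∈ Finset.univ.filter fun p => ∃ e : H ↪g G, (e : Fin h → V) = t p},
      ∃ e : H ↪g G, (e : Fin h → V) = t p.1 := fun p => (Finset.mem_filter.mp p.2).2
  choose e he using key
  have := Nat.card_le_card_of_injective e fun p q hpq => by
    have h2 := congrArg (fun e : H ↪g G => (e : Fin h → V)) hpq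
    simp only [he] at h2
    exact Subtype.ext (ht h2)
  rw [Nat.card_eq_fintype_card, Fintype.card_coe] at this
  exact_mod_cast this

theorem sum_copyInd_four_le [Fintype V] (H : SimpleGraph (Fin 4)) :
    ∑ a, ∑ b, ∑ c, ∑ d, G.copyInd H ![a, b, c, d] ≤ Nat.card (H ↪g G) := by
  have := G.sum_copyInd_le H (fun p : V × V × V × V => ![p.1, p.2.1, p.2.2.1, p.2.2.2]) (by
    rintro ⟨a, b, c, d⟩ ⟨a', b', c', d'⟩ h
    have h0 := congrFun h 0
    have h1 := congrFun h 1
    have h2 := congrFun h 2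
    have h3 := congrFun h 3
    simp at h0 h1 h2 h3
    simp [h0, h1, h2, h3])
  simpa only [Fintype.sum_prod_type] using this

theorem sum_copyInd_five_le [Fintype V] (H : SimpleGraph (Fin 5)) :
    ∑ a, ∑ b, ∑ c, ∑ d, ∑ e, G.copyInd H ![a, b, c, d, e] ≤ Nat.card (H ↪g G) := by
  have := G.sum_copyInd_le H
    (fun p : V × V × V × V × V => ![p.1, p.2.1, p.2.2.1, p.2.2.2.1, p.2.2.2.2]) (by
    rintro ⟨a, b, c, d, e⟩ ⟨a', b', c', d', e'⟩ h
    have h0 := congrFun h 0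
    have h1 := congrFun h 1
    have h2 := congrFun h 2
    have h3 := congrFun h 3
    have h4 := congrFun h 4
    simp at h0 h1 h2 h3 h4
    simp [h0, h1, h2, h3, h4])
  simpa only [Fintype.sum_prod_type] using this

theorem le_copyInd {h : ℕ} {H : SimpleGraph (Fin h)} {f : Fin h → V} {x : ℝ}
    (hx : x ∈ unitInterval) (hf : x ≠ 0 → ∃ e : H ↪g G, (e : Fin h → V) = f) :
    x ≤ G.copyInd H f := by
  by_cases h : x = 0
  · rw [h]; exact G.copyInd_nonneg H f
  · rw [copyInd, if_pos (hf h)]; exact hx.2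

theorem adjInd_mem (v w : V) : G.adjInd v w ∈ unitInterval :=
  ⟨G.adjInd_nonneg v w, G.adjInd_le_one v w⟩

theorem one_sub_adjInd_mem (v w : V) : 1 - G.adjInd v w ∈ unitInterval :=
  ⟨sub_nonneg.mpr (G.adjInd_le_one v w), sub_le_self _ (G.adjInd_nonneg v w)⟩

theorem adjInd_eq_zero {v w : V} : G.adjInd v w = 0 ↔ ¬ G.Adj v w := by
  unfold adjInd; split_ifs with h <;> simp [h]

theorem one_sub_adjInd_eq_zero {v w : V} : 1 - G.adjInd v w = 0 ↔ G.Adj v w := by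
  unfold adjInd; split_ifs with h <;> simp [h]

theorem exists_embedding_of_lt {h : ℕ} {H : SimpleGraph (Fin h)} {f : Fin h → V}
    (hadj : ∀ i j, i < j → (G.Adj (f i) (f j) ↔ H.Adj i j)) (hne : ∀ i j, i < j → f i ≠ f j) :
    ∃ e : H ↪g G, (e : Fin h → V) = f := by
  refine ⟨⟨⟨f, fun i j hij => ?_⟩, fun {i j} => ?_⟩, rfl⟩
  · rcases lt_trichotomy i j with h | h | h
    · exact absurd hij (hne i j h)
    · exact h
    · exact absurd hij.symm (hne j i h)
  · rcases lt_trichotomy i j with hij | rfl | hij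
    · exact hadj i j hij
    · simp
    · rw [G.adj_comm, H.adj_comm]; exact hadj j i hij

theorem exists_cycleGraph_four_embedding {a b c d : V} (hab : G.Adj a b) (hbc : G.Adj b c)
    (hcd : G.Adj c d) (hda : G.Adj d a) (hac : ¬ G.Adj a c) (hbd : ¬ G.Adj b d) (hac' : a ≠ c)
    (hbd' : b ≠ d) : ∃ e : cycleGraph 4 ↪g G, (e : Fin 4 → V) = ![a, b, c, d] := by
  apply G.exists_embedding_of_lt <;> intro i j hij <;> fin_cases i <;> fin_cases j <;>
    first
    | exact absurd hij (by decide)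
    | exact iff_of_true hab (by decide)
    | exact iff_of_true hbc (by decide)
    | exact iff_of_true hcd (by decide)
    | exact iff_of_true hda.symm (by decide)
    | exact iff_of_false hac (by decide)
    | exact iff_of_false hbd (by decide)
    | exact hab.ne
    | exact hbc.ne
    | exact hcd.ne
    | exact hda.ne'
    | exact hac'
    | exact hbd'

theorem exists_compl_cycleGraph_four_embedding {a b c d : V} (hac : G.Adj a c) (hbd : G.Adj b d)
    (hab : ¬ G.Adj a b) (hbc : ¬ G.Adj b c) (hcd : ¬ G.Adj c d) (hda : ¬ G.Adj d a) :
    ∃ e : (cycleGraph 4)ᶜ ↪g G, (e : Fin 4 → V) = ![a, b, c, d] := by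
  have h1 : a ≠ b := fun h => hbc (h ▸ hac)
  have h2 : b ≠ c := fun h => hab (h ▸ hac)
  have h3 : c ≠ d := fun h => hbc (h ▸ hbd)
  have h4 : d ≠ a := fun h => hcd (h ▸ hac.symm)
  have hcompl : ∃ e : cycleGraph 4 ↪g Gᶜ, (e : Fin 4 → V) = ![a, b, c, d] :=
    exists_cycleGraph_four_embedding Gᶜ ⟨h1, hab⟩ ⟨h2, hbc⟩ ⟨h3, hcd⟩ ⟨h4, hda⟩
      (fun h => h.2 hac) (fun h => h.2 hbd) hac.ne hbd.ne
  obtain ⟨e, he⟩ := hcompl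
  refine ⟨⟨e.toEmbedding, fun {i j} => ?_⟩, he⟩
  have hadj := e.map_adj_iff (v := i) (w := j)
  have hinj := e.injective.eq_iff (a := i) (b := j)
  simp only [compl_adj] at hadj ⊢
  change G.Adj (e i) (e j) ↔ _
  by_cases hij : i = j
  · simp [hij]
  · have : e i ≠ e j := fun h => hij (hinj.mp h)
    tauto

theorem exists_cycleGraph_five_embedding {a b c d e : V} (hab : G.Adj a b) (hbc : G.Adj b c)
    (hcd : G.Adj c d) (hde : G.Adj d e) (hea : G.Adj e a) (hac : ¬ G.Adj a c) (hbd : ¬ G.Adj b d)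
    (hce : ¬ G.Adj c e) (hda : ¬ G.Adj d a) (heb : ¬ G.Adj e b) :
    ∃ f : cycleGraph 5 ↪g G, (f : Fin 5 → V) = ![a, b, c, d, e] := by
  -- A five-cycle has no two vertices with the same neighbours, so distinctness is automatic.
  have hac' : a ≠ c := fun h => hce (h ▸ hea.symm)
  have hbd' : b ≠ d := fun h => hda (h ▸ hab.symm)
  have hce' : c ≠ e := fun h => heb (h ▸ hbc.symm)
  have hda' : d ≠ a := fun h => hac (h ▸ hcd.symm)
  have heb' : e ≠ b := fun h => hbd (h ▸ hde.symm)
  apply G.exists_embedding_of_lt <;> intro i j hij <;> fin_cases i <;> fin_cases j <;>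
    first
    | exact absurd hij (by decide)
    | exact iff_of_true hab (by decide)
    | exact iff_of_true hbc (by decide)
    | exact iff_of_true hcd (by decide)
    | exact iff_of_true hde (by decide)
    | exact iff_of_true hea.symm (by decide)
    | exact iff_of_false hac (by decide)
    | exact iff_of_false hbd (by decide)
    | exact iff_of_false hce (by decide)
    | exact iff_of_false (mt Adj.symm hda) (by decide)
    | exact iff_of_false (mt Adj.symm heb) (by decide)
    | exact hab.ne
    | exact hbc.ne
    | exact hcd.ne
    | exact hde.ne
    | exact hea.ne'
    | exact hac'
    | exact hbd'
    | exact hce'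
    | exact hda'.symm
    | exact heb'.symm

end Copies

/-! ### Graphs of small maximum degree without sparse pairs -/

section Expanding

variable {V : Type v} [Fintype V] {G : SimpleGraph V} {c : ℝ}

/-- `G` has maximum degree at most `|V| / 40` and no `c`-sparse pair `(A, B)` with
`|A| ≥ c ^ 18 * |V|` and `|B| ≥ |V| / 40`. The exponent is chosen large enough for all the counting
arguments below, and `c` is taken so small that one more power of `c` absorbs a constant factor. -/
structure IsExpanding (G : SimpleGraph V) (c : ℝ) : Prop where
  pos : 0 < c
  le : c ≤ 1 / 200
  two_le : 2 ≤ Fintype.card V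
  degInto_le : ∀ v, G.degInto v Finset.univ ≤ (Fintype.card V : ℝ) / 40
  lt_edgeSum : ∀ A B : Finset V, Disjoint A B → c ^ 18 * (Fintype.card V : ℝ) ≤ #A →
    (Fintype.card V : ℝ) / 40 ≤ #B → c * #A * #B < G.edgeSum A B

open Classical in
/-- The set of neighbours of `v`. -/
noncomputable def nbr (G : SimpleGraph V) (v : V) : Finset V := Finset.univ.filter (G.Adj v)

open Classical in
/-- The vertices of `K` adjacent to `v` and not to `w`. -/
noncomputable def privateNbr (G : SimpleGraph V) (v w : V) (K : Finset V) : Finset V :=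
  K.filter fun x => G.Adj v x ∧ ¬ G.Adj w x

open Classical in
/-- The vertices that are adjacent neither to `v` nor to `w`. -/
noncomputable def coNbr (G : SimpleGraph V) (v w : V) : Finset V :=
  Finset.univ.filter fun x => ¬ G.Adj v x ∧ ¬ G.Adj w x

@[simp] theorem mem_nbr {v x : V} : x ∈ G.nbr v ↔ G.Adj v x := by simp [nbr]

@[simp] theorem mem_coNbr {v w x : V} : x ∈ G.coNbr v w ↔ ¬ G.Adj v x ∧ ¬ G.Adj w x := by
  simp [coNbr]

theorem card_nbr (v : V) : (#(G.nbr v) : ℝ) = G.degInto v Finset.univ := by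
  rw [degInto_eq_card, nbr]

omit [Fintype V] in
theorem sum_privateNbr (v w : V) (K : Finset V) (f : V → ℝ) :
    ∑ x ∈ G.privateNbr v w K, f x =
      ∑ x ∈ K, G.adjInd v x * (1 - G.adjInd w x) * f x := by
  rw [privateNbr, Finset.sum_filter]
  refine Finset.sum_congr rfl fun x _ => ?_
  unfold adjInd
  split_ifs <;> simp_all

omit [Fintype V] in
theorem card_privateNbr (v w : V) (K : Finset V) :
    (#(G.privateNbr v w K) : ℝ) = ∑ x ∈ K, G.adjInd v x * (1 - G.adjInd w x) := by
  simpa using sum_privateNbr (G := G) v w K (fun _ => 1)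

theorem sum_coNbr (v w : V) (f : V → ℝ) :
    ∑ x ∈ G.coNbr v w, f x = ∑ x, (1 - G.adjInd v x) * (1 - G.adjInd w x) * f x := by
  rw [coNbr, Finset.sum_filter]
  refine Finset.sum_congr rfl fun x _ => ?_
  unfold adjInd
  split_ifs <;> simp_all

theorem sum_nbr (v : V) (f : V → ℝ) : ∑ x ∈ G.nbr v, f x = ∑ x, G.adjInd v x * f x := by
  rw [nbr, Finset.sum_filter]
  refine Finset.sum_congr rfl fun x _ => ?_
  unfold adjInd
  split_ifs <;> simp_all

omit [Fintype V] in
/-- The larger half of a set with respect to a real-valued function. -/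
theorem exists_subset_top (M : Finset V) (f : V → ℝ) (k : ℕ) (hk : k ≤ #M) :
    ∃ A ⊆ M, #A = k ∧ ∀ a ∈ A, ∀ b ∈ M, b ∉ A → f b ≤ f a := by
  classical
  induction k with
  | zero => exact ⟨∅, Finset.empty_subset _, rfl, by simp⟩
  | succ k ih =>
    obtain ⟨A, hA, hAk, htop⟩ := ih (by omega)
    have hne : (M \ A).Nonempty := Finset.card_pos.mp (by
      rw [Finset.card_sdiff_of_subset hA]; omega)
    obtain ⟨x, hx, hmax⟩ := (M \ A).exists_max_image f hne
    have hx' := Finset.mem_sdiff.mp hx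
    refine ⟨insert x A, Finset.insert_subset hx'.1 hA, by
      rw [Finset.card_insert_of_notMem hx'.2, hAk], ?_⟩
    intro a ha b hb hbA
    rw [Finset.mem_insert, not_or] at hbA
    rcases Finset.mem_insert.mp ha with rfl | ha
    · exact hmax b (Finset.mem_sdiff.mpr ⟨hb, hbA.2⟩)
    · exact htop a ha b hb hbA.2

namespace IsExpanding

local notation "n" => (Fintype.card V : ℝ)

theorem one_lt (hG : G.IsExpanding c) : 1 < c ^ 18 * n := by
  classical
  by_contra hle
  push Not at hle
  have h2 : (2 : ℝ) ≤ n := by exact_mod_cast hG.two_le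
  obtain ⟨v⟩ : Nonempty V := Fintype.card_pos_iff.mp (by have := hG.two_le; omega)
  set B : Finset V := Finset.univ \ insert v (G.nbr v) with hB
  have hBcard : n ≤ #B + (n / 40 + 1) := by
    have h1 : (#(insert v (G.nbr v)) : ℝ) ≤ n / 40 + 1 := by
      have : (#(insert v (G.nbr v)) : ℝ) ≤ #(G.nbr v) + 1 := by
        exact_mod_cast Finset.card_insert_le _ _
      have := hG.degInto_le v
      rw [← card_nbr] at this
      linarith
    have h2 : (Fintype.card V : ℝ) ≤ #B + #(insert v (G.nbr v)) := by
      have := Finset.le_card_sdiff (insert v (G.nbr v)) (Finset.univ : Finset V)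
      rw [Finset.card_univ] at this
      exact_mod_cast Nat.sub_le_iff_le_add.mp this
    linarith
  have h := hG.lt_edgeSum {v} B (by simp [hB]) (by simpa using hle) (by linarith)
  have h0 : G.edgeSum {v} B = 0 := by
    rw [edgeSum, Finset.sum_singleton, degInto]
    refine Finset.sum_eq_zero fun b hb => ?_
    rw [adjInd_eq_zero]
    intro hvb
    simp [hB, hvb] at hb
  rw [h0] at h
  have : 0 ≤ c * #({v} : Finset V) * #B := by have := hG.pos; positivity
  linarith

theorem pow_le (hG : G.IsExpanding c) {k : ℕ} (hk : 1 ≤ k) : c ^ k ≤ 1 / 200 := by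
  calc c ^ k ≤ c ^ 1 := pow_le_pow_of_le_one hG.pos.le (hG.le.trans (by norm_num)) hk
    _ ≤ _ := by simpa using hG.le

/-- Absorbing a constant factor into one power of `c`. -/
theorem pow_succ_le (hG : G.IsExpanding c) (k : ℕ) : c ^ (k + 1) ≤ 1 / 200 * c ^ k := by
  rw [pow_succ, mul_comm]
  exact mul_le_mul_of_nonneg_right hG.le (pow_nonneg hG.pos.le _)

theorem pow_le_pow (hG : G.IsExpanding c) {k l : ℕ} (h : k ≤ l) : c ^ l ≤ c ^ k :=
  pow_le_pow_of_le_one hG.pos.le (hG.le.trans (by norm_num)) h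

theorem card_gt (hG : G.IsExpanding c) : 200 < n := by
  have h1 := hG.one_lt
  have h2 := hG.pow_le (k := 18) (by norm_num)
  have h3 : (0 : ℝ) ≤ n := by positivity
  nlinarith

theorem card_nbr_le (hG : G.IsExpanding c) (v : V) : (#(G.nbr v) : ℝ) ≤ n / 40 := by
  rw [card_nbr]; exact hG.degInto_le v

theorem card_coNbr_ge (hG : G.IsExpanding c) (v w : V) : 19 / 20 * n ≤ #(G.coNbr v w) := by
  classical
  have h : (Finset.univ : Finset V) ⊆ G.coNbr v w ∪ (G.nbr v ∪ G.nbr w) := fun x _ => by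
    simp only [Finset.mem_union, mem_coNbr, mem_nbr]; tauto
  have h1 : n ≤ #(G.coNbr v w) + (#(G.nbr v) + #(G.nbr w)) := by
    have h2 := (Finset.card_le_card h).trans ((Finset.card_union_le _ _).trans
      (Nat.add_le_add_left (Finset.card_union_le _ _) _))
    rw [Finset.card_univ] at h2
    exact_mod_cast h2
  have := hG.card_nbr_le v
  have := hG.card_nbr_le w
  linarith

open Classical in
/-- All but few vertices have many neighbours in a given set `A` that is not too small. -/
theorem card_few_nbrs_le (hG : G.IsExpanding c) {A : Finset V} (h1 : c ^ 18 * n ≤ #A)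
    (h2 : #A ≤ n / 40) :
    (#(Finset.univ.filter fun v => G.degInto v A < c * #A) : ℝ) ≤ n / 20 := by
  set S := Finset.univ.filter fun v => G.degInto v A < c * #A with hS
  by_contra hlt
  push Not at hlt
  have hcard : (#S : ℝ) ≤ #(S \ A) + #A := by
    exact_mod_cast Nat.sub_le_iff_le_add.mp (Finset.le_card_sdiff A S)
  have h := hG.lt_edgeSum A (S \ A) Finset.disjoint_sdiff h1 (by linarith)
  rw [edgeSum_comm] at h
  have h3 : G.edgeSum (S \ A) A ≤ #(S \ A) * (c * #A) := by
    simpa [edgeSum] using Finset.sum_le_card_nsmul (S \ A) (fun v => G.degInto v A) (c * #A)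
      fun v hv => ((Finset.mem_filter.mp (Finset.mem_sdiff.mp hv).1).2).le
  linarith

open Classical in
/-- All but very few vertices have many neighbours in a given set `B` of linear size. -/
theorem card_few_nbrs_lt (hG : G.IsExpanding c) {B : Finset V} (hB : n / 20 ≤ #B) :
    (#(Finset.univ.filter fun v => G.degInto v B < c / 2 * #B) : ℝ) < c ^ 18 * n := by
  set S := Finset.univ.filter fun v => G.degInto v B < c / 2 * #B with hS
  by_contra hlt
  push Not at hlt
  obtain ⟨A, hAS, hA⟩ := Finset.exists_subset_card_eq (Nat.ceil_le.mpr hlt)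
  have h1 : c ^ 18 * n ≤ #A := by rw [hA]; exact Nat.le_ceil _
  have hc := hG.pos
  have h2 : (#A : ℝ) ≤ n / 40 := by
    have := Nat.ceil_lt_add_one (a := c ^ 18 * n) (by positivity)
    rw [hA]
    have := hG.pow_le (k := 18) (by norm_num)
    have := hG.card_gt
    nlinarith
  have h3 : (#B : ℝ) ≤ #(B \ A) + #A := by
    exact_mod_cast Nat.sub_le_iff_le_add.mp (Finset.le_card_sdiff A B)
  have h := hG.lt_edgeSum A (B \ A) Finset.disjoint_sdiff h1 (by linarith)
  have h4 : G.edgeSum A (B \ A) ≤ #A * (c / 2 * #B) := by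
    refine (G.edgeSum_mono subset_rfl Finset.sdiff_subset).trans ?_
    simpa [edgeSum] using Finset.sum_le_card_nsmul A (fun v => G.degInto v B) (c / 2 * #B)
      fun v hv => ((Finset.mem_filter.mp (hAS hv)).2).le
  have h5 : (#B : ℝ) / 2 ≤ #(B \ A) := by linarith
  have h6 : (#A : ℝ) * (c / 2 * #B) ≤ c * #A * #(B \ A) := by
    calc (#A : ℝ) * (c / 2 * #B) = c * #A * (#B / 2) := by ring
      _ ≤ _ := by gcongr
  linarith

open Classical in
/-- All but very few vertices have linearly many neighbours, up to a factor `c`, outside the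
neighbourhoods of two given vertices. -/
theorem card_few_coNbrs_lt (hG : G.IsExpanding c) (v w : V) :
    (#(Finset.univ.filter fun x => G.degInto x (G.coNbr v w) < 2 / 5 * c * n) : ℝ) <
      c ^ 18 * n := by
  have hn := hG.card_gt
  have hco := hG.card_coNbr_ge v w
  have hc := hG.pos
  refine lt_of_le_of_lt ?_ (hG.card_few_nbrs_lt (B := G.coNbr v w) (by linarith))
  refine Nat.cast_le.mpr (Finset.card_le_card fun x hx => ?_)
  rw [Finset.mem_filter] at hx ⊢
  refine ⟨hx.1, hx.2.trans_le ?_⟩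
  nlinarith

end IsExpanding

omit [Fintype V] in
theorem sum_comm_four {A B C D : Finset V} (f : V → V → V → V → ℝ) :
    ∑ a ∈ A, ∑ b ∈ B, ∑ x ∈ C, ∑ y ∈ D, f a b x y =
      ∑ x ∈ C, ∑ y ∈ D, ∑ a ∈ A, ∑ b ∈ B, f a b x y := by
  calc _ = ∑ p ∈ A ×ˢ B, ∑ q ∈ C ×ˢ D, f p.1 p.2 q.1 q.2 := by simp only [Finset.sum_product]
    _ = ∑ q ∈ C ×ˢ D, ∑ p ∈ A ×ˢ B, f p.1 p.2 q.1 q.2 := Finset.sum_comm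
    _ = _ := by simp only [Finset.sum_product]

omit [Fintype V] in
theorem card_privateNbr_sub (v w : V) (K : Finset V) :
    (#(G.privateNbr v w K) : ℝ) - #(G.privateNbr w v K) = G.degInto v K - G.degInto w K := by
  rw [card_privateNbr, card_privateNbr, degInto, degInto, ← Finset.sum_sub_distrib,
    ← Finset.sum_sub_distrib]
  exact Finset.sum_congr rfl fun x _ => by ring

namespace IsExpanding

local notation "n" => (Fintype.card V : ℝ)

/-- Most vertices have many neighbours in each of two given sets. -/
theorem sum_degInto_mul_degInto_ge (hG : G.IsExpanding c) {K K' : Finset V}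
    (hK : c ^ 18 * n ≤ #K) (hKn : #K ≤ n / 40) (hK' : c ^ 18 * n ≤ #K') (hKn' : #K' ≤ n / 40)
    (S : Finset V) :
    (#S - n / 10) * (c ^ 2 * #K * #K') ≤ ∑ r ∈ S, G.degInto r K * G.degInto r K' := by
  classical
  have hc := hG.pos
  set B := Finset.univ.filter fun v => G.degInto v K < c * #K
  set B' := Finset.univ.filter fun v => G.degInto v K' < c * #K'
  have hB : (#B : ℝ) ≤ n / 20 := hG.card_few_nbrs_le hK hKn
  have hB' : (#B' : ℝ) ≤ n / 20 := hG.card_few_nbrs_le hK' hKn'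
  have hcard : (#S : ℝ) - n / 10 ≤ #(S \ (B ∪ B')) := by
    have h1 : (#S : ℝ) ≤ #(S \ (B ∪ B')) + #(B ∪ B') := by
      exact_mod_cast Nat.sub_le_iff_le_add.mp (Finset.le_card_sdiff (B ∪ B') S)
    have h2 : (#(B ∪ B') : ℝ) ≤ #B + #B' := by exact_mod_cast Finset.card_union_le _ _
    linarith
  calc (#S - n / 10) * (c ^ 2 * #K * #K') ≤ #(S \ (B ∪ B')) * (c ^ 2 * #K * #K') := by gcongr
    _ = ∑ r ∈ S \ (B ∪ B'), (c * #K) * (c * #K') := by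
        rw [Finset.sum_const, nsmul_eq_mul]; ring
    _ ≤ ∑ r ∈ S \ (B ∪ B'), G.degInto r K * G.degInto r K' := by
        refine Finset.sum_le_sum fun r hr => ?_
        have h1 := (Finset.mem_sdiff.mp hr).2
        have h2 : c * #K ≤ G.degInto r K := by
          by_contra h
          exact h1 (Finset.mem_union_left _ (Finset.mem_filter.mpr
            ⟨Finset.mem_univ _, not_le.mp h⟩))
        have h3 : c * #K' ≤ G.degInto r K' := by
          by_contra h
          exact h1 (Finset.mem_union_right _ (Finset.mem_filter.mpr
            ⟨Finset.mem_univ _, not_le.mp h⟩))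
        exact mul_le_mul h2 h3 (by positivity) (G.degInto_nonneg _ _)
    _ ≤ _ := Finset.sum_le_sum_of_subset_of_nonneg Finset.sdiff_subset fun r _ _ =>
        mul_nonneg (G.degInto_nonneg _ _) (G.degInto_nonneg _ _)

open Classical in
/-- Given two sets `K` and `K'` that are not too small, there are many edges `vw` such that `v` has
many private neighbours in `K` and `w` has many private neighbours in `K'`.

To see this, split the vertices outside `K ∪ K'` into the half `A₁` with the most neighbours in `K`
and the other half `A₂`. For `x ∈ K` and `x' ∈ K'`, there are many edges between the common
neighbours of `x, x'` in `A₂` and the common non-neighbours of `x, x'` in `A₁`. Each such edge has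
both `x` and `x'` as private neighbours of its end in `A₂`; but on `K` the end in `A₁` has at least
as many private neighbours as the end in `A₂`. -/
theorem sum_card_privateNbr_ge (hG : G.IsExpanding c) {K K' : Finset V}
    (hK : c ^ 18 * n ≤ #K) (hKn : #K ≤ n / 40) (hK' : c ^ 18 * n ≤ #K') (hKn' : #K' ≤ n / 40) :
    c ^ 4 * n ^ 2 * #K * #K' ≤ ∑ v ∈ (K ∪ K')ᶜ, ∑ w ∈ (K ∪ K')ᶜ,
      G.adjInd v w * (#(G.privateNbr w v K') * #(G.privateNbr v w K)) := by
  have hc := hG.pos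
  have hn := hG.card_gt
  set M := (K ∪ K')ᶜ with hM
  have hMcard : 19 / 20 * n ≤ #M := by
    have h1 : (#(K ∪ K') : ℝ) ≤ #K + #K' := by exact_mod_cast Finset.card_union_le _ _
    have h2 : (#M : ℝ) = n - #(K ∪ K') := by
      rw [hM, Finset.card_compl, Nat.cast_sub (Finset.card_le_univ _)]
    linarith
  obtain ⟨A₁, hA₁, hA₁card, htop⟩ := exists_subset_top M (fun v => G.degInto v K) (#M / 2)
    (Nat.div_le_self _ _)
  set A₂ := M \ A₁ with hA₂
  have hA₂card : #A₂ = #M - #M / 2 := by rw [hA₂, Finset.card_sdiff_of_subset hA₁, hA₁card]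
  have hA₁n : 2 / 5 * n ≤ #A₁ := by
    have : (#M : ℝ) ≤ 2 * #A₁ + 1 := by exact_mod_cast (by omega : #M ≤ 2 * #A₁ + 1)
    linarith
  have hA₂n : 2 / 5 * n ≤ #A₂ := by
    have : (#M : ℝ) ≤ 2 * #A₂ + 1 := by exact_mod_cast (by omega : #M ≤ 2 * #A₂ + 1)
    linarith
  -- The number of edges described above for a given pair `x, x'`.
  set F : V → V → V → V → ℝ := fun x x' w v => G.adjInd w v *
    ((G.adjInd w x * (1 - G.adjInd v x)) * (G.adjInd w x' * (1 - G.adjInd v x'))) with hF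
  have hxx : ∀ x x', 7 / 20 * c * n * ((∑ w ∈ A₂, G.adjInd w x * G.adjInd w x') - c ^ 18 * n) ≤
      ∑ w ∈ A₂, ∑ v ∈ A₁, F x x' w v := by
    intro x x'
    set S := A₂.filter fun w => G.Adj x w ∧ G.Adj x' w with hS
    set R := A₁ ∩ G.coNbr x x' with hR
    have hScard : (#S : ℝ) = ∑ w ∈ A₂, G.adjInd w x * G.adjInd w x' := by
      rw [hS, Finset.card_filter]
      push_cast
      refine Finset.sum_congr rfl fun w _ => ?_
      simp only [G.adjInd_comm w]
      unfold adjInd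
      split_ifs <;> simp_all
    have hRcard : 7 / 20 * n ≤ #R := by
      have h1 : A₁ ⊆ R ∪ (G.nbr x ∪ G.nbr x') := fun y hy => by
        simp only [hR, Finset.mem_union, Finset.mem_inter, mem_coNbr, mem_nbr, hy]; tauto
      have h2 : (#A₁ : ℝ) ≤ #R + (#(G.nbr x) + #(G.nbr x')) := by
        exact_mod_cast (Finset.card_le_card h1).trans ((Finset.card_union_le _ _).trans
          (Nat.add_le_add_left (Finset.card_union_le _ _) _))
      have := hG.card_nbr_le x
      have := hG.card_nbr_le x'
      linarith
    have hSR : Disjoint S R :=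
      Disjoint.mono (Finset.filter_subset _ _) Finset.inter_subset_left Finset.sdiff_disjoint
    have hsum : G.edgeSum S R = ∑ w ∈ A₂, ∑ v ∈ A₁, F x x' w v := by
      rw [edgeSum, hS, Finset.sum_filter]
      refine Finset.sum_congr rfl fun w _ => ?_
      rw [degInto, hR, coNbr, Finset.inter_filter, Finset.inter_univ]
      simp only [hF, G.adjInd_comm _ x, G.adjInd_comm _ x']
      by_cases hw : G.Adj x w ∧ G.Adj x' w
      · rw [if_pos hw, Finset.sum_filter]
        refine Finset.sum_congr rfl fun v _ => ?_
        have h1 : G.adjInd x w = 1 := if_pos hw.1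
        have h2 : G.adjInd x' w = 1 := if_pos hw.2
        rw [h1, h2]
        by_cases hv : ¬ G.Adj x v ∧ ¬ G.Adj x' v
        · rw [if_pos hv, G.adjInd_eq_zero.mpr hv.1, G.adjInd_eq_zero.mpr hv.2]; ring
        · rw [if_neg hv]
          have : (1 - G.adjInd x v) * (1 - G.adjInd x' v) = 0 := by
            rw [mul_eq_zero, one_sub_adjInd_eq_zero, one_sub_adjInd_eq_zero]; tauto
          linear_combination (-G.adjInd w v) * this
      · rw [if_neg hw]
        have : G.adjInd x w * G.adjInd x' w = 0 := by
          rw [mul_eq_zero, adjInd_eq_zero, adjInd_eq_zero]; tauto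
        refine (Finset.sum_eq_zero fun v _ => ?_).symm
        linear_combination
          (G.adjInd w v * (1 - G.adjInd x v) * (1 - G.adjInd x' v)) * this
    rw [← hsum, ← hScard]
    rcases le_or_gt (c ^ 18 * n) #S with h | h
    · have h1 := hG.lt_edgeSum S R hSR h (by linarith)
      calc 7 / 20 * c * n * (#S - c ^ 18 * n) ≤ 7 / 20 * c * n * #S := by
            have : 0 ≤ c ^ 18 * n := by positivity
            gcongr; linarith
        _ = c * #S * (7 / 20 * n) := by ring
        _ ≤ c * #S * #R := by gcongr
        _ ≤ _ := h1.le
    · refine le_trans (mul_nonpos_of_nonneg_of_nonpos (by positivity) (by linarith))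
        (G.edgeSum_nonneg _ _)
  have hcodeg : 3 / 10 * n * (c ^ 2 * #K * #K') ≤
      ∑ x ∈ K, ∑ x' ∈ K', ∑ w ∈ A₂, G.adjInd w x * G.adjInd w x' := by
    calc 3 / 10 * n * (c ^ 2 * #K * #K') ≤ (#A₂ - n / 10) * (c ^ 2 * #K * #K') := by
          gcongr; linarith
      _ ≤ ∑ w ∈ A₂, G.degInto w K * G.degInto w K' :=
          hG.sum_degInto_mul_degInto_ge hK hKn hK' hKn' A₂
      _ = ∑ w ∈ A₂, ∑ x ∈ K, ∑ x' ∈ K', G.adjInd w x * G.adjInd w x' :=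
          Finset.sum_congr rfl fun w _ => by rw [degInto, degInto, Finset.sum_mul_sum]
      _ = ∑ x ∈ K, ∑ w ∈ A₂, ∑ x' ∈ K', G.adjInd w x * G.adjInd w x' := Finset.sum_comm
      _ = _ := Finset.sum_congr rfl fun x _ => Finset.sum_comm
  have hlower : c ^ 4 * n ^ 2 * #K * #K' ≤ ∑ x ∈ K, ∑ x' ∈ K', ∑ w ∈ A₂, ∑ v ∈ A₁, F x x' w v := by
    have h1 : 7 / 20 * c * n * ((∑ x ∈ K, ∑ x' ∈ K', ∑ w ∈ A₂, G.adjInd w x * G.adjInd w x') -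
        #K * #K' * (c ^ 18 * n)) ≤ ∑ x ∈ K, ∑ x' ∈ K', ∑ w ∈ A₂, ∑ v ∈ A₁, F x x' w v := by
      have := Finset.sum_le_sum fun x (_ : x ∈ K) =>
        Finset.sum_le_sum fun x' (_ : x' ∈ K') => hxx x x'
      refine le_trans (le_of_eq ?_) this
      simp only [← Finset.mul_sum, Finset.sum_sub_distrib, Finset.sum_const, nsmul_eq_mul]
      ring
    refine le_trans ?_ h1
    have h2 : c ^ 18 ≤ 1 / 10 * c ^ 2 := by
      have := hG.pow_succ_le 2
      have := hG.pow_le_pow (k := 3) (l := 18) (by norm_num)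
      have : 0 ≤ c ^ 2 := by positivity
      linarith
    have h3 : c ^ 4 ≤ 7 / 100 * c ^ 3 := by
      have := hG.pow_succ_le 3
      have : 0 ≤ c ^ 3 := by positivity
      linarith
    calc c ^ 4 * n ^ 2 * #K * #K' ≤ 7 / 100 * c ^ 3 * n ^ 2 * #K * #K' := by gcongr
      _ = 7 / 20 * c * n * (3 / 10 * n * (c ^ 2 * #K * #K') -
          #K * #K' * (1 / 10 * c ^ 2 * n)) := by ring
      _ ≤ _ := by gcongr
  have hswap : ∑ x ∈ K, ∑ x' ∈ K', ∑ w ∈ A₂, ∑ v ∈ A₁, F x x' w v =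
      ∑ w ∈ A₂, ∑ v ∈ A₁, G.adjInd w v * (#(G.privateNbr w v K) * #(G.privateNbr w v K')) := by
    rw [sum_comm_four]
    refine Finset.sum_congr rfl fun w _ => Finset.sum_congr rfl fun v _ => ?_
    rw [card_privateNbr, card_privateNbr, Finset.sum_mul_sum, Finset.mul_sum]
    exact Finset.sum_congr rfl fun x _ => by rw [Finset.mul_sum]
  have hnn : ∀ v w, 0 ≤ G.adjInd v w * (#(G.privateNbr w v K') * #(G.privateNbr v w K) : ℝ) :=
    fun v w => mul_nonneg (G.adjInd_nonneg _ _) (by positivity)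
  calc c ^ 4 * n ^ 2 * #K * #K'
      ≤ ∑ w ∈ A₂, ∑ v ∈ A₁, G.adjInd w v * (#(G.privateNbr w v K) * #(G.privateNbr w v K')) :=
        hlower.trans_eq hswap
    _ ≤ ∑ w ∈ A₂, ∑ v ∈ A₁,
          G.adjInd v w * (#(G.privateNbr w v K') * #(G.privateNbr v w K)) := by
        refine Finset.sum_le_sum fun w hw => Finset.sum_le_sum fun v hv => ?_
        rw [G.adjInd_comm w v, mul_comm (#(G.privateNbr w v K) : ℝ)]
        have h1 : G.degInto w K ≤ G.degInto v K :=
          htop v hv w (Finset.mem_sdiff.mp hw).1 (Finset.mem_sdiff.mp hw).2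
        have h2 := card_privateNbr_sub (G := G) v w K
        exact mul_le_mul_of_nonneg_left
          (mul_le_mul_of_nonneg_left (by linarith) (Nat.cast_nonneg _)) (G.adjInd_nonneg v w)
    _ = ∑ v ∈ A₁, ∑ w ∈ A₂, _ := Finset.sum_comm
    _ ≤ ∑ v ∈ A₁, ∑ w ∈ M, G.adjInd v w * (#(G.privateNbr w v K') * #(G.privateNbr v w K)) :=
        Finset.sum_le_sum fun v _ => Finset.sum_le_sum_of_subset_of_nonneg Finset.sdiff_subset
          fun w _ _ => hnn v w
    _ ≤ _ := Finset.sum_le_sum_of_subset_of_nonneg hA₁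
          fun v _ _ => Finset.sum_nonneg fun w _ => hnn v w

open Classical in
/-- Most pairs of vertices are non-adjacent and have many common neighbours. -/
theorem sum_ge_of_codegree (hG : G.IsExpanding c) {f : V → V → ℝ} {t : ℝ} (hf : ∀ u x, 0 ≤ f u x)
    (ht : 0 ≤ t) (h : ∀ u x, Gᶜ.Adj u x → c ^ 3 * n ≤ G.degInto x (G.nbr u) → t ≤ f u x) :
    n ^ 2 / 4 * t ≤ ∑ u, ∑ x, f u x := by
  have hc := hG.pos
  have hn := hG.card_gt
  have h18 := hG.pow_le (k := 18) (by norm_num)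
  have h18' : c ^ 18 * n ≤ 1 / 200 * n := by gcongr
  set B := Finset.univ.filter fun u => G.degInto u Finset.univ < c / 2 * #(Finset.univ : Finset V)
  have hB : (#B : ℝ) < c ^ 18 * n :=
    hG.card_few_nbrs_lt (B := Finset.univ) (by rw [Finset.card_univ]; linarith)
  have hBc : n / 2 ≤ #Bᶜ := by
    rw [Finset.card_compl, Nat.cast_sub (Finset.card_le_univ _)]
    linarith
  have hu : ∀ u ∈ Bᶜ, n / 2 * t ≤ ∑ x, f u x := by
    intro u hu
    have hdeg : c / 2 * n ≤ #(G.nbr u) := by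
      rw [card_nbr]
      by_contra hlt
      exact Finset.mem_compl.mp hu (Finset.mem_filter.mpr ⟨Finset.mem_univ _, by
        rw [Finset.card_univ]; exact not_le.mp hlt⟩)
    set D := Finset.univ.filter fun x => G.degInto x (G.nbr u) < c * #(G.nbr u)
    have hD : (#D : ℝ) ≤ n / 20 := by
      refine hG.card_few_nbrs_le (le_trans ?_ hdeg) (hG.card_nbr_le u)
      have h1 := hG.pow_succ_le 1
      have h2 := hG.pow_le_pow (k := 2) (l := 18) (by norm_num)
      have : c ^ 18 ≤ c / 2 := by norm_num at h1; linarith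
      gcongr
    set E := (D ∪ insert u (G.nbr u))ᶜ with hE
    have hEcard : n / 2 ≤ #E := by
      have h1 : (#(D ∪ insert u (G.nbr u)) : ℝ) ≤ #D + (#(G.nbr u) + 1) := by
        exact_mod_cast (Finset.card_union_le _ _).trans
          (Nat.add_le_add_left (Finset.card_insert_le _ _) _)
      have h2 := hG.card_nbr_le u
      rw [hE, Finset.card_compl, Nat.cast_sub (Finset.card_le_univ _)]
      linarith
    calc n / 2 * t ≤ #E * t := by gcongr
      _ = ∑ x ∈ E, t := by simp
      _ ≤ ∑ x ∈ E, f u x := by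
          refine Finset.sum_le_sum fun x hx => ?_
          simp only [hE, Finset.mem_compl, Finset.mem_union, Finset.mem_insert, mem_nbr,
            not_or] at hx
          refine h u x ⟨fun hh => hx.2.1 hh.symm, hx.2.2⟩ ?_
          have h1 : c * #(G.nbr u) ≤ G.degInto x (G.nbr u) := by
            by_contra hlt
            exact hx.1 (Finset.mem_filter.mpr ⟨Finset.mem_univ _, not_le.mp hlt⟩)
          refine le_trans ?_ h1
          have h2 := hG.pow_succ_le 2
          calc c ^ 3 * n ≤ c * (c / 2 * n) := by
                have : 0 ≤ c ^ 2 * n := by positivity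
                nlinarith
            _ ≤ _ := by gcongr
      _ ≤ _ := Finset.sum_le_univ_sum_of_nonneg fun x => hf u x
  calc n ^ 2 / 4 * t = n / 2 * (n / 2 * t) := by ring
    _ ≤ #Bᶜ * (n / 2 * t) := by gcongr
    _ = ∑ u ∈ Bᶜ, n / 2 * t := by simp
    _ ≤ ∑ u ∈ Bᶜ, ∑ x, f u x := Finset.sum_le_sum hu
    _ ≤ _ := Finset.sum_le_univ_sum_of_nonneg fun u => Finset.sum_nonneg fun x _ => hf u x

end IsExpanding

theorem sum_sum_le_univ {f : V → V → ℝ} (hf : ∀ a b, 0 ≤ f a b) (A B : Finset V) :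
    ∑ a ∈ A, ∑ b ∈ B, f a b ≤ ∑ a, ∑ b, f a b :=
  (Finset.sum_le_sum fun a _ => Finset.sum_le_univ_sum_of_nonneg (hf a)).trans
    (Finset.sum_le_univ_sum_of_nonneg fun a => Finset.sum_nonneg fun b _ => hf a b)

namespace IsExpanding

local notation "n" => (Fintype.card V : ℝ)

/-! ### The complement of the four-cycle -/

/-- A sparse expanding graph has many induced subgraphs with two disjoint edges: take any edge, and
then any edge among the vertices that have no neighbour on it. -/
theorem card_compl_cycleGraph_four_ge (hG : G.IsExpanding c) :
    c ^ 18 * n ^ 4 ≤ (Nat.card ((cycleGraph 4)ᶜ ↪g G) : ℝ) := by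
  classical
  have hc := hG.pos
  have hn := hG.card_gt
  have h18 := hG.pow_le (k := 18) (by norm_num)
  have h18' : c ^ 18 * n ≤ 1 / 200 * n := by gcongr
  have hc1 := hG.le
  have hE : ∀ u v, c ^ 2 * n ^ 2 ≤ G.edgeSum (G.coNbr u v) (G.coNbr u v) := by
    intro u v
    set M := G.coNbr u v with hM
    set D := Finset.univ.filter fun x => G.degInto x M < 2 / 5 * c * n
    have hD : (#D : ℝ) < c ^ 18 * n := hG.card_few_coNbrs_lt u v
    have h1 : 9 / 10 * n ≤ #(M \ D) := by
      have h2 : (#M : ℝ) ≤ #(M \ D) + #D := by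
        exact_mod_cast Nat.sub_le_iff_le_add.mp (Finset.le_card_sdiff D M)
      have := hG.card_coNbr_ge u v
      linarith
    calc c ^ 2 * n ^ 2 ≤ 9 / 10 * n * (2 / 5 * c * n) := by
          have : c ^ 2 ≤ 9 / 25 * c := by nlinarith
          calc c ^ 2 * n ^ 2 ≤ 9 / 25 * c * n ^ 2 := by gcongr
            _ = _ := by ring
      _ ≤ #(M \ D) * (2 / 5 * c * n) := by gcongr
      _ = ∑ x ∈ M \ D, 2 / 5 * c * n := by simp
      _ ≤ ∑ x ∈ M \ D, G.degInto x M := by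
          refine Finset.sum_le_sum fun x hx => ?_
          by_contra hlt
          exact (Finset.mem_sdiff.mp hx).2 (Finset.mem_filter.mpr
            ⟨Finset.mem_univ _, not_le.mp hlt⟩)
      _ ≤ _ := Finset.sum_le_sum_of_subset_of_nonneg Finset.sdiff_subset
          fun x _ _ => G.degInto_nonneg _ _
  have hdeg : c ^ 2 * n ^ 2 ≤ ∑ u, ∑ v, G.adjInd u v := by
    set D := Finset.univ.filter fun x => G.degInto x Finset.univ < c / 2 * #(Finset.univ : Finset V)
    have hD : (#D : ℝ) < c ^ 18 * n :=
      hG.card_few_nbrs_lt (B := Finset.univ) (by rw [Finset.card_univ]; linarith)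
    have h1 : 9 / 10 * n ≤ #Dᶜ := by
      rw [Finset.card_compl, Nat.cast_sub (Finset.card_le_univ _)]
      linarith
    calc c ^ 2 * n ^ 2 ≤ 9 / 10 * n * (c / 2 * n) := by
          have : c ^ 2 ≤ 9 / 20 * c := by nlinarith
          calc c ^ 2 * n ^ 2 ≤ 9 / 20 * c * n ^ 2 := by gcongr
            _ = _ := by ring
      _ ≤ #Dᶜ * (c / 2 * n) := by gcongr
      _ = ∑ x ∈ Dᶜ, c / 2 * n := by simp
      _ ≤ ∑ x ∈ Dᶜ, ∑ v, G.adjInd x v := by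
          refine Finset.sum_le_sum fun x hx => ?_
          by_contra hlt
          exact (Finset.mem_compl.mp hx) (Finset.mem_filter.mpr
            ⟨Finset.mem_univ _, by rw [Finset.card_univ]; exact not_le.mp hlt⟩)
      _ ≤ _ := Finset.sum_le_univ_sum_of_nonneg
          fun x => Finset.sum_nonneg fun y _ => G.adjInd_nonneg _ _
  have hpoint : ∀ u v, G.adjInd u v * (c ^ 2 * n ^ 2) ≤
      ∑ p, ∑ q, G.copyInd (cycleGraph 4)ᶜ ![u, p, v, q] := by
    intro u v
    refine le_trans ?_ (sum_sum_le_univ (fun p q => G.copyInd_nonneg _ _) (G.coNbr u v)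
      (G.coNbr u v))
    calc G.adjInd u v * (c ^ 2 * n ^ 2)
        ≤ G.adjInd u v * G.edgeSum (G.coNbr u v) (G.coNbr u v) :=
          mul_le_mul_of_nonneg_left (hE u v) (G.adjInd_nonneg _ _)
      _ = ∑ p ∈ G.coNbr u v, ∑ q ∈ G.coNbr u v, G.adjInd u v * G.adjInd p q := by
          simp only [edgeSum, degInto, Finset.mul_sum]
      _ ≤ _ := by
          refine Finset.sum_le_sum fun p hp => Finset.sum_le_sum fun q hq => ?_
          rw [mem_coNbr] at hp hq
          refine G.le_copyInd (unitInterval.mul_mem (G.adjInd_mem _ _) (G.adjInd_mem _ _))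
            fun hne => ?_
          simp only [ne_eq, mul_eq_zero, not_or, adjInd_eq_zero, not_not] at hne
          exact G.exists_compl_cycleGraph_four_embedding hne.1 hne.2 hp.1 (mt Adj.symm hp.2) hq.2
            (mt Adj.symm hq.1)
  calc c ^ 18 * n ^ 4 ≤ c ^ 4 * n ^ 4 := by
        gcongr ?_ * _; exact hG.pow_le_pow (by norm_num)
    _ = c ^ 2 * n ^ 2 * (c ^ 2 * n ^ 2) := by ring
    _ ≤ (∑ u, ∑ v, G.adjInd u v) * (c ^ 2 * n ^ 2) := by gcongr
    _ = ∑ u, ∑ v, G.adjInd u v * (c ^ 2 * n ^ 2) := by simp only [Finset.sum_mul]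
    _ ≤ ∑ u, ∑ v, ∑ p, ∑ q, G.copyInd (cycleGraph 4)ᶜ ![u, p, v, q] :=
        Finset.sum_le_sum fun u _ => Finset.sum_le_sum fun v _ => hpoint u v
    _ = ∑ u, ∑ p, ∑ v, ∑ q, G.copyInd (cycleGraph 4)ᶜ ![u, p, v, q] :=
        Finset.sum_congr rfl fun u _ => Finset.sum_comm
    _ ≤ _ := G.sum_copyInd_four_le _

/-! ### The four-cycle -/

/-- A nearly complete set `K` yields many four-cycles: combine an edge `vw` outside `K` with a
private neighbour of `v` and a private neighbour of `w` in `K`. -/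
theorem card_cycleGraph_four_ge_of_dense (hG : G.IsExpanding c) {K : Finset V}
    (hK : c ^ 3 * n ≤ #K) (hKn : #K ≤ n / 40) (hdense : Gᶜ.edgeSum K K ≤ c ^ 5 * (#K : ℝ) ^ 2) :
    c ^ 18 * n ^ 4 ≤ (Nat.card (cycleGraph 4 ↪g G) : ℝ) := by
  classical
  have hc := hG.pos
  have hK18 : c ^ 18 * n ≤ #K := by
    refine le_trans ?_ hK
    gcongr ?_ * _
    exact hG.pow_le_pow (by norm_num)
  have hmain := hG.sum_card_privateNbr_ge hK18 hKn hK18 hKn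
  rw [Finset.union_self] at hmain
  have hMn : (#Kᶜ : ℝ) ≤ n := by exact_mod_cast Finset.card_le_univ _
  have hpoint : ∀ v ∈ Kᶜ, ∀ w ∈ Kᶜ,
      G.adjInd v w * (#(G.privateNbr w v K) * #(G.privateNbr v w K)) - Gᶜ.edgeSum K K ≤
        ∑ y, ∑ x, G.copyInd (cycleGraph 4) ![v, w, y, x] := by
    intro v hv w hw
    refine le_trans ?_ (sum_sum_le_univ (fun p q => G.copyInd_nonneg _ _) K K)
    calc G.adjInd v w * (#(G.privateNbr w v K) * #(G.privateNbr v w K)) - Gᶜ.edgeSum K K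
        = ∑ y ∈ K, ∑ x ∈ K, (G.adjInd v w * ((G.adjInd w y * (1 - G.adjInd v y)) *
            (G.adjInd v x * (1 - G.adjInd w x))) - Gᶜ.adjInd y x) := by
          rw [card_privateNbr, card_privateNbr, Finset.sum_mul_sum]
          simp only [Finset.sum_sub_distrib, edgeSum, degInto, Finset.mul_sum]
      _ ≤ _ := by
          refine Finset.sum_le_sum fun y hy => Finset.sum_le_sum fun x hx => ?_
          set z := G.adjInd v w * ((G.adjInd w y * (1 - G.adjInd v y)) *
            (G.adjInd v x * (1 - G.adjInd w x))) with hz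
          have hzmem : z ∈ unitInterval :=
            unitInterval.mul_mem (G.adjInd_mem _ _) (unitInterval.mul_mem
              (unitInterval.mul_mem (G.adjInd_mem _ _) (G.one_sub_adjInd_mem _ _))
              (unitInterval.mul_mem (G.adjInd_mem _ _) (G.one_sub_adjInd_mem _ _)))
          have h1 : z * (1 - Gᶜ.adjInd y x) ≤ G.copyInd (cycleGraph 4) ![v, w, y, x] := by
            refine G.le_copyInd (unitInterval.mul_mem hzmem (Gᶜ.one_sub_adjInd_mem _ _))
              fun hne => ?_
            simp only [hz, ne_eq, mul_eq_zero, not_or, adjInd_eq_zero, one_sub_adjInd_eq_zero,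
              not_not] at hne
            obtain ⟨⟨hvw, ⟨hwy, hvy⟩, hvx, hwx⟩, hyx⟩ := hne
            have hyx' : G.Adj y x := by
              by_contra hh
              refine hyx ⟨?_, hh⟩
              rintro rfl
              exact hvy hvx
            exact G.exists_cycleGraph_four_embedding hvw hwy hyx' hvx.symm hvy hwx
              (fun h => Finset.mem_compl.mp hv (h ▸ hy)) (fun h => Finset.mem_compl.mp hw (h ▸ hx))
          have h2 := mul_le_mul_of_nonneg_right hzmem.2 (Gᶜ.adjInd_nonneg y x)
          linarith
  have hfin : c ^ 18 * n ^ 4 ≤ c ^ 4 * n ^ 2 * #K * #K - n * n * Gᶜ.edgeSum K K := by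
    have h1 : c ^ 12 ≤ 1 / 2 * c ^ 10 := by
      have := hG.pow_succ_le 10
      have := hG.pow_le_pow (k := 11) (l := 12) (by norm_num)
      have : 0 ≤ c ^ 10 := by positivity
      linarith
    have h2 : c ^ 5 ≤ 1 / 2 * c ^ 4 := by
      have := hG.pow_succ_le 4
      have : 0 ≤ c ^ 4 := by positivity
      linarith
    calc c ^ 18 * n ^ 4 ≤ c ^ 12 * n ^ 4 := by
          gcongr ?_ * _; exact hG.pow_le_pow (by norm_num)
      _ ≤ 1 / 2 * c ^ 10 * n ^ 4 := by gcongr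
      _ = 1 / 2 * c ^ 4 * n ^ 2 * (c ^ 3 * n) ^ 2 := by ring
      _ ≤ 1 / 2 * c ^ 4 * n ^ 2 * (#K : ℝ) ^ 2 := by gcongr
      _ = c ^ 4 * n ^ 2 * #K * #K - n * n * (1 / 2 * c ^ 4 * (#K : ℝ) ^ 2) := by ring
      _ ≤ _ := by
          gcongr
          exact hdense.trans (by gcongr)
  calc c ^ 18 * n ^ 4 ≤ c ^ 4 * n ^ 2 * #K * #K - n * n * Gᶜ.edgeSum K K := hfin
    _ ≤ (∑ v ∈ Kᶜ, ∑ w ∈ Kᶜ, G.adjInd v w * (#(G.privateNbr w v K) * #(G.privateNbr v w K))) -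
          #Kᶜ * #Kᶜ * Gᶜ.edgeSum K K := by
        have := Gᶜ.edgeSum_nonneg K K
        gcongr
    _ = ∑ v ∈ Kᶜ, ∑ w ∈ Kᶜ, (G.adjInd v w * (#(G.privateNbr w v K) * #(G.privateNbr v w K)) -
          Gᶜ.edgeSum K K) := by
        simp only [Finset.sum_sub_distrib, Finset.sum_const, nsmul_eq_mul]
        ring
    _ ≤ ∑ v ∈ Kᶜ, ∑ w ∈ Kᶜ, ∑ y, ∑ x, G.copyInd (cycleGraph 4) ![v, w, y, x] :=
        Finset.sum_le_sum fun v hv => Finset.sum_le_sum fun w hw => hpoint v hv w hw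
    _ ≤ ∑ v, ∑ w, ∑ y, ∑ x, G.copyInd (cycleGraph 4) ![v, w, y, x] :=
        sum_sum_le_univ (fun v w => Finset.sum_nonneg fun y _ => Finset.sum_nonneg fun x _ =>
          G.copyInd_nonneg _ _) _ _
    _ ≤ _ := G.sum_copyInd_four_le _

/-- A sparse expanding graph has many induced four-cycles: if common neighbourhoods of non-adjacent
vertices contain many non-edges, these give four-cycles directly, and otherwise some common
neighbourhood is nearly complete. -/
theorem card_cycleGraph_four_ge (hG : G.IsExpanding c) :
    c ^ 18 * n ^ 4 ≤ (Nat.card (cycleGraph 4 ↪g G) : ℝ) := by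
  classical
  have hc := hG.pos
  by_cases hdense : ∃ K : Finset V, c ^ 3 * n ≤ #K ∧ #K ≤ n / 40 ∧
      Gᶜ.edgeSum K K ≤ c ^ 5 * (#K : ℝ) ^ 2
  · obtain ⟨K, h1, h2, h3⟩ := hdense
    exact hG.card_cycleGraph_four_ge_of_dense h1 h2 h3
  have hmany := hG.sum_ge_of_codegree
    (f := fun u v => ∑ x, ∑ y, G.copyInd (cycleGraph 4) ![u, x, v, y]) (t := c ^ 11 * n ^ 2)
    (fun u v => Finset.sum_nonneg fun x _ => Finset.sum_nonneg fun y _ => G.copyInd_nonneg _ _)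
    (by positivity) (fun u v huv hcodeg => by
      set K := (G.nbr u).filter (G.Adj v) with hK
      have hKcard : c ^ 3 * n ≤ #K := by rw [hK, ← degInto_eq_card]; exact hcodeg
      have hKn : (#K : ℝ) ≤ n / 40 :=
        (Nat.cast_le.mpr (Finset.card_le_card (Finset.filter_subset _ _))).trans
          (hG.card_nbr_le u)
      have hE : c ^ 5 * (#K : ℝ) ^ 2 ≤ Gᶜ.edgeSum K K :=
        (not_le.mp fun h => hdense ⟨K, hKcard, hKn, h⟩).le
      calc c ^ 11 * n ^ 2 = c ^ 5 * (c ^ 3 * n) ^ 2 := by ring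
        _ ≤ c ^ 5 * (#K : ℝ) ^ 2 := by gcongr
        _ ≤ Gᶜ.edgeSum K K := hE
        _ = ∑ x ∈ K, ∑ y ∈ K, Gᶜ.adjInd x y := rfl
        _ ≤ ∑ x ∈ K, ∑ y ∈ K, G.copyInd (cycleGraph 4) ![u, x, v, y] := by
            refine Finset.sum_le_sum fun x hx => Finset.sum_le_sum fun y hy => ?_
            rw [hK, Finset.mem_filter, mem_nbr] at hx hy
            refine G.le_copyInd (Gᶜ.adjInd_mem _ _) fun hne => ?_
            rw [ne_eq, adjInd_eq_zero, not_not] at hne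
            exact G.exists_cycleGraph_four_embedding hx.1 hx.2.symm hy.2 hy.1.symm huv.2 hne.2
              huv.1 hne.1
        _ ≤ _ := sum_sum_le_univ (fun x y => G.copyInd_nonneg _ _) K K)
  calc c ^ 18 * n ^ 4 ≤ c ^ 12 * n ^ 4 := by
        gcongr ?_ * _; exact hG.pow_le_pow (by norm_num)
    _ ≤ 1 / 4 * c ^ 11 * n ^ 4 := by
        have := hG.pow_succ_le 11
        have : 0 ≤ c ^ 11 := by positivity
        gcongr ?_ * _
        linarith
    _ = n ^ 2 / 4 * (c ^ 11 * n ^ 2) := by ring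
    _ ≤ _ := hmany
    _ = ∑ u, ∑ x, ∑ v, ∑ y, G.copyInd (cycleGraph 4) ![u, x, v, y] :=
        Finset.sum_congr rfl fun u _ => Finset.sum_comm
    _ ≤ _ := G.sum_copyInd_four_le _

/-! ### The five-cycle -/

/-- Two sets `P`, `Q` contained in small sets have many common neighbours among the vertices
adjacent neither to `v` nor to `w`. The subtracted term makes this trivial if `P` or `Q` is tiny. -/
theorem sum_coNbr_ge (hG : G.IsExpanding c) (v w : V) {P Q : Finset V}
    (hP : #P ≤ n / 40) (hQ : #Q ≤ n / 40) :
    c ^ 3 * n * (#P * #Q - c ^ 18 * n ^ 2) ≤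
      ∑ r ∈ G.coNbr v w, G.degInto r P * G.degInto r Q := by
  have hc := hG.pos
  have hn := hG.card_gt
  have hnn : 0 ≤ ∑ r ∈ G.coNbr v w, G.degInto r P * G.degInto r Q :=
    Finset.sum_nonneg fun r _ => mul_nonneg (G.degInto_nonneg _ _) (G.degInto_nonneg _ _)
  rcases lt_or_ge (#P : ℝ) (c ^ 18 * n) with h1 | h1
  · refine le_trans (mul_nonpos_of_nonneg_of_nonpos (by positivity) ?_) hnn
    have : (#P : ℝ) * #Q ≤ c ^ 18 * n * n := by gcongr; exact Finset.card_le_univ _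
    linarith
  rcases lt_or_ge (#Q : ℝ) (c ^ 18 * n) with h2 | h2
  · refine le_trans (mul_nonpos_of_nonneg_of_nonpos (by positivity) ?_) hnn
    have : (#P : ℝ) * #Q ≤ n * (c ^ 18 * n) := by gcongr; exact Finset.card_le_univ _
    linarith
  refine le_trans ?_ (hG.sum_degInto_mul_degInto_ge h1 hP h2 hQ (G.coNbr v w))
  have h3 := hG.card_coNbr_ge v w
  have h4 : c ^ 3 ≤ 1 / 2 * c ^ 2 := by
    have := hG.pow_succ_le 2
    have : 0 ≤ c ^ 2 := by positivity
    linarith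
  have h5 : 0 ≤ c ^ 18 * n ^ 2 := by positivity
  calc c ^ 3 * n * (#P * #Q - c ^ 18 * n ^ 2) ≤ c ^ 3 * n * (#P * #Q) := by gcongr; linarith
    _ ≤ 1 / 2 * c ^ 2 * n * (#P * #Q) := by gcongr
    _ = n / 2 * (c ^ 2 * #P * #Q) := by ring
    _ ≤ _ := by gcongr; linarith

/-- If there are few five-cycles, then there are many edges between any two sets that are small but
not too small: otherwise take an edge `vw`, a private neighbour of `v` in one set, a private
neighbour of `w` in the other, and a common neighbour of the latter two. -/
theorem edgeSum_ge_of_few_cycleGraph_five (hG : G.IsExpanding c)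
    (hfew : (Nat.card (cycleGraph 5 ↪g G) : ℝ) < c ^ 18 * n ^ 5) {K K' : Finset V}
    (hK : c ^ 2 * n ≤ #K) (hKn : #K ≤ n / 40) (hK' : c ^ 2 * n ≤ #K') (hKn' : #K' ≤ n / 40) :
    c ^ 12 * n ^ 2 ≤ G.edgeSum K' K := by
  classical
  have hc := hG.pos
  have hn := hG.card_gt
  have h18 : c ^ 18 * n ≤ c ^ 2 * n := by
    gcongr ?_ * _
    exact hG.pow_le_pow (by norm_num)
  have hmain := hG.sum_card_privateNbr_ge (h18.trans hK) hKn (h18.trans hK') hKn'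
  set M := (K ∪ K')ᶜ with hM
  have hMn : (#M : ℝ) ≤ n := by exact_mod_cast Finset.card_le_univ _
  have hpoint : ∀ v w, c ^ 3 * n * (G.adjInd v w *
        (#(G.privateNbr w v K') * #(G.privateNbr v w K)) - c ^ 18 * n ^ 2) -
        n * G.edgeSum K' K ≤ ∑ y, ∑ r, ∑ x, G.copyInd (cycleGraph 5) ![v, w, y, r, x] := by
    intro v w
    set P := G.privateNbr v w K with hP
    set Q := G.privateNbr w v K' with hQ
    have hPn : (#P : ℝ) ≤ n / 40 :=
      (Nat.cast_le.mpr (Finset.card_le_card (Finset.filter_subset _ _))).trans hKn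
    have hQn : (#Q : ℝ) ≤ n / 40 :=
      (Nat.cast_le.mpr (Finset.card_le_card (Finset.filter_subset _ _))).trans hKn'
    have h1 := hG.sum_coNbr_ge v w hQn hPn
    have ha := G.adjInd_mem v w
    have hE := G.edgeSum_nonneg K' K
    have hexp : G.adjInd v w * (∑ r ∈ G.coNbr v w, G.degInto r Q * G.degInto r P) =
        ∑ r, ∑ y ∈ K', ∑ x ∈ K, G.adjInd v w * (((1 - G.adjInd v r) * (1 - G.adjInd w r)) *
          ((G.adjInd w y * (1 - G.adjInd v y) * G.adjInd r y) *
            (G.adjInd v x * (1 - G.adjInd w x) * G.adjInd r x))) := by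
      simp only [degInto, hP, hQ, sum_privateNbr]
      rw [sum_coNbr]
      simp only [Finset.sum_mul_sum]
      simp only [Finset.mul_sum]
    calc c ^ 3 * n * (G.adjInd v w * (#Q * #P) - c ^ 18 * n ^ 2) - n * G.edgeSum K' K
        ≤ G.adjInd v w * (c ^ 3 * n * (#Q * #P - c ^ 18 * n ^ 2)) - n * G.edgeSum K' K := by
          have h2 : 0 ≤ c ^ 3 * n * (c ^ 18 * n ^ 2) := by positivity
          have h3 := mul_le_mul_of_nonneg_right ha.2 h2
          linarith
      _ ≤ G.adjInd v w * (∑ r ∈ G.coNbr v w, G.degInto r Q * G.degInto r P) -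
            n * G.edgeSum K' K := by
          have := mul_le_mul_of_nonneg_left h1 ha.1
          linarith
      _ = ∑ r, ∑ y ∈ K', ∑ x ∈ K, (G.adjInd v w * (((1 - G.adjInd v r) * (1 - G.adjInd w r)) *
          ((G.adjInd w y * (1 - G.adjInd v y) * G.adjInd r y) *
            (G.adjInd v x * (1 - G.adjInd w x) * G.adjInd r x))) - G.adjInd y x) := by
          rw [hexp]
          simp only [Finset.sum_sub_distrib, edgeSum, degInto, Finset.sum_const, nsmul_eq_mul,
            Finset.card_univ]
      _ ≤ ∑ r, ∑ y ∈ K', ∑ x ∈ K, G.copyInd (cycleGraph 5) ![v, w, y, r, x] := by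
          refine Finset.sum_le_sum fun r _ => Finset.sum_le_sum fun y _ =>
            Finset.sum_le_sum fun x _ => ?_
          set z := G.adjInd v w * (((1 - G.adjInd v r) * (1 - G.adjInd w r)) *
            ((G.adjInd w y * (1 - G.adjInd v y) * G.adjInd r y) *
              (G.adjInd v x * (1 - G.adjInd w x) * G.adjInd r x))) with hz
          have hzmem : z ∈ unitInterval := by
            repeat' apply unitInterval.mul_mem
            all_goals first | exact G.adjInd_mem _ _ | exact G.one_sub_adjInd_mem _ _
          have h1 : z * (1 - G.adjInd y x) ≤ G.copyInd (cycleGraph 5) ![v, w, y, r, x] := by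
            refine G.le_copyInd (unitInterval.mul_mem hzmem (G.one_sub_adjInd_mem _ _))
              fun hne => ?_
            simp only [hz, ne_eq, mul_eq_zero, not_or, adjInd_eq_zero, one_sub_adjInd_eq_zero,
              not_not] at hne
            obtain ⟨⟨hvw, ⟨hvr, hwr⟩, ⟨⟨hwy, hvy⟩, hry⟩, ⟨hvx, hwx⟩, hrx⟩, hyx⟩ := hne
            exact G.exists_cycleGraph_five_embedding hvw hwy hry.symm hrx hvx.symm hvy hwr hyx
              (mt Adj.symm hvr) (mt Adj.symm hwx)
          have h2 := mul_le_mul_of_nonneg_right hzmem.2 (G.adjInd_nonneg y x)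
          linarith
      _ ≤ ∑ r, ∑ y, ∑ x, G.copyInd (cycleGraph 5) ![v, w, y, r, x] :=
          Finset.sum_le_sum fun r _ => sum_sum_le_univ (fun y x => G.copyInd_nonneg _ _) _ _
      _ = _ := Finset.sum_comm
  by_contra hlt
  push Not at hlt
  have hsum : c ^ 3 * n * (c ^ 4 * n ^ 2 * #K * #K' - n * n * (c ^ 18 * n ^ 2)) -
      n * n * (n * G.edgeSum K' K) ≤ Nat.card (cycleGraph 5 ↪g G) := by
    have hE := G.edgeSum_nonneg K' K
    calc c ^ 3 * n * (c ^ 4 * n ^ 2 * #K * #K' - n * n * (c ^ 18 * n ^ 2)) -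
          n * n * (n * G.edgeSum K' K)
        ≤ c ^ 3 * n * ((∑ v ∈ M, ∑ w ∈ M, G.adjInd v w *
            (#(G.privateNbr w v K') * #(G.privateNbr v w K))) - #M * #M * (c ^ 18 * n ^ 2)) -
          #M * #M * (n * G.edgeSum K' K) := by gcongr
      _ = ∑ v ∈ M, ∑ w ∈ M, (c ^ 3 * n * (G.adjInd v w *
            (#(G.privateNbr w v K') * #(G.privateNbr v w K)) - c ^ 18 * n ^ 2) -
          n * G.edgeSum K' K) := by
          simp only [Finset.sum_sub_distrib, ← Finset.mul_sum, Finset.sum_const, nsmul_eq_mul]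
          ring
      _ ≤ ∑ v ∈ M, ∑ w ∈ M, ∑ y, ∑ r, ∑ x, G.copyInd (cycleGraph 5) ![v, w, y, r, x] :=
          Finset.sum_le_sum fun v _ => Finset.sum_le_sum fun w _ => hpoint v w
      _ ≤ ∑ v, ∑ w, ∑ y, ∑ r, ∑ x, G.copyInd (cycleGraph 5) ![v, w, y, r, x] :=
          sum_sum_le_univ (fun v w => Finset.sum_nonneg fun y _ => Finset.sum_nonneg fun r _ =>
            Finset.sum_nonneg fun x _ => G.copyInd_nonneg _ _) _ _
      _ ≤ _ := G.sum_copyInd_five_le _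
  have hlow : c ^ 11 * n ^ 5 ≤ c ^ 3 * n * (c ^ 4 * n ^ 2 * #K * #K') := by
    calc c ^ 11 * n ^ 5 = c ^ 3 * n * (c ^ 4 * n ^ 2 * (c ^ 2 * n) * (c ^ 2 * n)) := by ring
      _ ≤ _ := by gcongr
  have hE5 : n * n * (n * G.edgeSum K' K) ≤ c ^ 12 * n ^ 5 := by
    calc n * n * (n * G.edgeSum K' K) ≤ n * n * (n * (c ^ 12 * n ^ 2)) := by gcongr
      _ = _ := by ring
  have h21 : c ^ 21 ≤ c ^ 12 := hG.pow_le_pow (by norm_num)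
  have h18' : c ^ 18 ≤ c ^ 12 := hG.pow_le_pow (by norm_num)
  have h12 := hG.pow_succ_le 11
  have h11 : 0 < c ^ 11 := by positivity
  have hn5 : 0 < n ^ 5 := by positivity
  have h : c ^ 11 * n ^ 5 < (c ^ 21 + c ^ 12 + c ^ 18) * n ^ 5 := by
    have : c ^ 3 * n * (n * n * (c ^ 18 * n ^ 2)) = c ^ 21 * n ^ 5 := by ring
    linarith
  have := lt_of_mul_lt_mul_right h hn5.le
  norm_num at h12
  linarith

open Classical in
/-- The indicator of the vertices `x` that have few neighbours outside the neighbourhoods of `v` and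
`w`. -/
noncomputable def fewInd (G : SimpleGraph V) (c : ℝ) (v w x : V) : ℝ :=
  if G.degInto x (G.coNbr v w) < c ^ 2 * n then 1 else 0

theorem sum_fewInd_le (hG : G.IsExpanding c) (v w : V) :
    ∑ x, fewInd G c v w x ≤ c ^ 18 * n := by
  classical
  have hc := hG.pos
  have h1 : ∑ x, fewInd G c v w x =
      #(Finset.univ.filter fun x => G.degInto x (G.coNbr v w) < c ^ 2 * n) := by
    rw [Finset.card_filter]
    push_cast
    exact Finset.sum_congr rfl fun x _ => by unfold fewInd; congr
  rw [h1]
  refine le_trans (Nat.cast_le.mpr (Finset.card_le_card fun x hx => ?_))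
    (hG.card_few_coNbrs_lt v w).le
  rw [Finset.mem_filter] at hx ⊢
  refine ⟨hx.1, hx.2.trans_le ?_⟩
  have := hG.pow_succ_le 1
  gcongr
  norm_num at this
  linarith

/-- A sparse expanding graph has many induced five-cycles: there are many induced three-vertex paths
`abd`, and each extends to many five-cycles through an edge between the remaining neighbours of `a`
and those of `d`. -/
theorem card_cycleGraph_five_ge (hG : G.IsExpanding c) :
    c ^ 18 * n ^ 5 ≤ (Nat.card (cycleGraph 5 ↪g G) : ℝ) := by
  classical
  by_contra hfew
  push Not at hfew
  have hc := hG.pos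
  have hn := hG.card_gt
  have hpoint : ∀ a b d, c ^ 12 * n ^ 2 * (G.adjInd a b * G.adjInd d b * Gᶜ.adjInd a d -
      fewInd G c b d a - fewInd G c b a d) ≤
      ∑ y, ∑ x, G.copyInd (cycleGraph 5) ![a, b, d, y, x] := by
    intro a b d
    have hnn : 0 ≤ ∑ y, ∑ x, G.copyInd (cycleGraph 5) ![a, b, d, y, x] :=
      Finset.sum_nonneg fun y _ => Finset.sum_nonneg fun x _ => G.copyInd_nonneg _ _
    have hP3 : G.adjInd a b * G.adjInd d b * Gᶜ.adjInd a d ∈ unitInterval :=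
      unitInterval.mul_mem (unitInterval.mul_mem (G.adjInd_mem _ _) (G.adjInd_mem _ _))
        (Gᶜ.adjInd_mem _ _)
    have hfew0 : ∀ v w x, 0 ≤ fewInd G c v w x := fun v w x => by
      unfold fewInd; split_ifs <;> norm_num
    have hc12 : 0 ≤ c ^ 12 * n ^ 2 := by positivity
    by_cases h0 : G.adjInd a b * G.adjInd d b * Gᶜ.adjInd a d = 0
    · refine le_trans (mul_nonpos_of_nonneg_of_nonpos hc12 ?_) hnn
      rw [h0]
      linarith [hfew0 b d a, hfew0 b a d]
    by_cases ha : G.degInto a (G.coNbr b d) < c ^ 2 * n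
    · refine le_trans (mul_nonpos_of_nonneg_of_nonpos hc12 ?_) hnn
      have : fewInd G c b d a = 1 := if_pos ha
      linarith [hP3.2, hfew0 b a d]
    by_cases hd : G.degInto d (G.coNbr b a) < c ^ 2 * n
    · refine le_trans (mul_nonpos_of_nonneg_of_nonpos hc12 ?_) hnn
      have : fewInd G c b a d = 1 := if_pos hd
      linarith [hP3.2, hfew0 b d a]
    simp only [mul_eq_zero, not_or, adjInd_eq_zero, not_not] at h0
    obtain ⟨⟨hab, hdb⟩, had⟩ := h0
    set K := (G.coNbr b d).filter (G.Adj a) with hK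
    set K' := (G.coNbr b a).filter (G.Adj d) with hK'
    rw [degInto_eq_card, not_lt] at ha hd
    have hKn : (#K : ℝ) ≤ n / 40 :=
      (Nat.cast_le.mpr (Finset.card_le_card fun x hx =>
        mem_nbr.mpr (Finset.mem_filter.mp hx).2)).trans (hG.card_nbr_le a)
    have hKn' : (#K' : ℝ) ≤ n / 40 :=
      (Nat.cast_le.mpr (Finset.card_le_card fun x hx =>
        mem_nbr.mpr (Finset.mem_filter.mp hx).2)).trans (hG.card_nbr_le d)
    calc c ^ 12 * n ^ 2 * (G.adjInd a b * G.adjInd d b * Gᶜ.adjInd a d -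
          fewInd G c b d a - fewInd G c b a d) ≤ c ^ 12 * n ^ 2 :=
          mul_le_of_le_one_right hc12 (by linarith [hP3.2, hfew0 b d a, hfew0 b a d])
      _ ≤ G.edgeSum K' K := hG.edgeSum_ge_of_few_cycleGraph_five hfew ha hKn hd hKn'
      _ = ∑ y ∈ K', ∑ x ∈ K, G.adjInd y x := rfl
      _ ≤ ∑ y ∈ K', ∑ x ∈ K, G.copyInd (cycleGraph 5) ![a, b, d, y, x] := by
          refine Finset.sum_le_sum fun y hy => Finset.sum_le_sum fun x hx => ?_
          rw [hK, Finset.mem_filter, mem_coNbr] at hx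
          rw [hK', Finset.mem_filter, mem_coNbr] at hy
          refine G.le_copyInd (G.adjInd_mem _ _) fun hne => ?_
          rw [ne_eq, adjInd_eq_zero, not_not] at hne
          exact G.exists_cycleGraph_five_embedding hab hdb.symm hy.2 hne hx.2.symm had.2 hy.1.1
            hx.1.2 (mt Adj.symm hy.1.2) (mt Adj.symm hx.1.1)
      _ ≤ _ := sum_sum_le_univ (fun y x => G.copyInd_nonneg _ _) _ _
  have hpaths : 1 / 4 * c ^ 3 * n ^ 3 ≤
      ∑ a, ∑ b, ∑ d, G.adjInd a b * G.adjInd d b * Gᶜ.adjInd a d := by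
    have h := hG.sum_ge_of_codegree (t := c ^ 3 * n)
      (f := fun a d => ∑ b, G.adjInd a b * G.adjInd d b * Gᶜ.adjInd a d)
      (fun a d => Finset.sum_nonneg fun b _ => mul_nonneg (mul_nonneg (G.adjInd_nonneg _ _)
        (G.adjInd_nonneg _ _)) (Gᶜ.adjInd_nonneg _ _)) (by positivity) (fun a d had hcodeg => by
          have h1 : Gᶜ.adjInd a d = 1 := if_pos had
          simp only [h1, mul_one]
          rwa [degInto, sum_nbr] at hcodeg)
    calc 1 / 4 * c ^ 3 * n ^ 3 = n ^ 2 / 4 * (c ^ 3 * n) := by ring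
      _ ≤ _ := h
      _ = _ := Finset.sum_congr rfl fun a _ => Finset.sum_comm
  have hbad1 : ∑ a, ∑ b, ∑ d, fewInd G c b d a ≤ n * (n * (c ^ 18 * n)) := by
    rw [Finset.sum_comm]
    calc ∑ b, ∑ a, ∑ d, fewInd G c b d a = ∑ b, ∑ d, ∑ a, fewInd G c b d a :=
          Finset.sum_congr rfl fun b _ => Finset.sum_comm
      _ ≤ ∑ b : V, ∑ d : V, c ^ 18 * n :=
          Finset.sum_le_sum fun b _ => Finset.sum_le_sum fun d _ => hG.sum_fewInd_le b d
      _ = _ := by simp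
  have hbad2 : ∑ a, ∑ b, ∑ d, fewInd G c b a d ≤ n * (n * (c ^ 18 * n)) := by
    calc ∑ a, ∑ b, ∑ d, fewInd G c b a d ≤ ∑ a : V, ∑ b : V, c ^ 18 * n :=
          Finset.sum_le_sum fun a _ => Finset.sum_le_sum fun b _ => hG.sum_fewInd_le b a
      _ = _ := by simp
  have hsum : c ^ 12 * n ^ 2 * (1 / 4 * c ^ 3 * n ^ 3 - n * (n * (c ^ 18 * n)) -
      n * (n * (c ^ 18 * n))) ≤ Nat.card (cycleGraph 5 ↪g G) := by
    calc _ ≤ c ^ 12 * n ^ 2 * ((∑ a, ∑ b, ∑ d, G.adjInd a b * G.adjInd d b * Gᶜ.adjInd a d) -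
          (∑ a, ∑ b, ∑ d, fewInd G c b d a) - ∑ a, ∑ b, ∑ d, fewInd G c b a d) := by gcongr
      _ = ∑ a, ∑ b, ∑ d, c ^ 12 * n ^ 2 * (G.adjInd a b * G.adjInd d b * Gᶜ.adjInd a d -
          fewInd G c b d a - fewInd G c b a d) := by
          simp only [← Finset.mul_sum, Finset.sum_sub_distrib]
      _ ≤ ∑ a, ∑ b, ∑ d, ∑ y, ∑ x, G.copyInd (cycleGraph 5) ![a, b, d, y, x] :=
          Finset.sum_le_sum fun a _ => Finset.sum_le_sum fun b _ =>
            Finset.sum_le_sum fun d _ => hpoint a b d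
      _ ≤ _ := G.sum_copyInd_five_le _
  have h15 : 0 < c ^ 15 := by positivity
  have h16 := hG.pow_succ_le 15
  have h30 : c ^ 30 ≤ c ^ 16 := hG.pow_le_pow (by norm_num)
  have h18 : c ^ 18 ≤ c ^ 16 := hG.pow_le_pow (by norm_num)
  have hn5 : 0 < n ^ 5 := by positivity
  have h : (1 / 4 * c ^ 15 - 2 * c ^ 30) * n ^ 5 < c ^ 18 * n ^ 5 := by
    refine lt_of_eq_of_lt ?_ (hsum.trans_lt hfew)
    ring
  have := lt_of_mul_lt_mul_right h hn5.le
  norm_num at h16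
  linarith

end IsExpanding

end Expanding

/-! ### Classification of the graphs that are almost-bipartite along with their complements -/

section Classification

/-- The three pairs of a triple are neither all adjacent nor all non-adjacent. -/
def NotAllEqual (a b c : Bool) : Prop := ¬ (a = b ∧ a = c)

instance (a b c : Bool) : Decidable (NotAllEqual a b c) := by
  unfold NotAllEqual; infer_instance

/-- `i` and `j` are distinct vertices of `T`, adjacent precisely if `b` is true. -/
def Matches {m : ℕ} (T : SimpleGraph (Fin m)) (i j : Fin m) (b : Bool) : Prop :=
  i ≠ j ∧ (T.Adj i j ↔ b = true)

instance {m : ℕ} (T : SimpleGraph (Fin m)) [DecidableRel T.Adj] (i j : Fin m) (b : Bool) :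
    Decidable (Matches T i j b) := by
  unfold Matches; infer_instance

/-- `T` has an induced subgraph on four vertices with the prescribed adjacencies. -/
def HasFour {m : ℕ} (T : SimpleGraph (Fin m)) (b01 b02 b12 b03 b13 b23 : Bool) : Prop :=
  ∃ i j, Matches T i j b01 ∧ ∃ k, Matches T i k b02 ∧ Matches T j k b12 ∧
    ∃ l, Matches T i l b03 ∧ Matches T j l b13 ∧ Matches T k l b23

instance {m : ℕ} (T : SimpleGraph (Fin m)) [DecidableRel T.Adj] (b01 b02 b12 b03 b13 b23 : Bool) :
    Decidable (HasFour T b01 b02 b12 b03 b13 b23) := by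
  unfold HasFour; infer_instance

set_option maxRecDepth 10000 in
theorem hasFour_of_notAllEqual : ∀ b01 b02 b12 b03 b13 b23 : Bool, NotAllEqual b01 b02 b12 →
    NotAllEqual b01 b03 b13 → NotAllEqual b02 b03 b23 → NotAllEqual b12 b13 b23 →
    HasFour (cycleGraph 5) b01 b02 b12 b03 b13 b23 ∨
    HasFour (cycleGraph 4) b01 b02 b12 b03 b13 b23 ∨
    HasFour (cycleGraph 4)ᶜ b01 b02 b12 b03 b13 b23 := by decide

theorem exists_three_of_notAllEqual : ∀ b01 b02 b12 : Bool, NotAllEqual b01 b02 b12 →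
    ∃ i j, Matches (cycleGraph 5) i j b01 ∧ ∃ k, Matches (cycleGraph 5) i k b02 ∧
      Matches (cycleGraph 5) j k b12 := by decide

theorem exists_two : ∀ b01 : Bool, ∃ i j, Matches (cycleGraph 5) i j b01 := by decide

theorem not_adj_all_of_cliqueFree {W : Type u} {H : SimpleGraph W} (h : H.CliqueFree 3) {a b c : W}
    (hab : H.Adj a b) (hac : H.Adj a c) (hbc : H.Adj b c) : False := by
  classical
  exact h {a, b, c} (is3Clique_triple_iff.mpr ⟨hab, hac, hbc⟩)

open Classical in
theorem notAllEqual_of_cliqueFree {W : Type u} {H : SimpleGraph W} (h : H.CliqueFree 3)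
    (h' : Hᶜ.CliqueFree 3) {a b c : W} (hab : a ≠ b) (hac : a ≠ c) (hbc : b ≠ c) :
    NotAllEqual (decide (H.Adj a b)) (decide (H.Adj a c)) (decide (H.Adj b c)) := by
  rintro ⟨h1, h2⟩
  by_cases h0 : H.Adj a b
  · simp only [h0, decide_true] at h1 h2
    exact not_adj_all_of_cliqueFree h h0 (of_decide_eq_true h1.symm) (of_decide_eq_true h2.symm)
  · simp only [h0, decide_false] at h1 h2
    exact not_adj_all_of_cliqueFree h' ⟨hab, h0⟩ ⟨hac, of_decide_eq_false h1.symm⟩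
      ⟨hbc, of_decide_eq_false h2.symm⟩

open Classical in
theorem HasFour.nonempty_embedding {m : ℕ} {T : SimpleGraph (Fin m)} {H : SimpleGraph (Fin 4)}
    (h : HasFour T (decide (H.Adj 0 1)) (decide (H.Adj 0 2)) (decide (H.Adj 1 2))
      (decide (H.Adj 0 3)) (decide (H.Adj 1 3)) (decide (H.Adj 2 3))) : Nonempty (H ↪g T) := by
  obtain ⟨i, j, h01, k, h02, h12, l, h03, h13, h23⟩ := h
  simp only [Matches, decide_eq_true_eq] at h01 h02 h12 h03 h13 h23
  obtain ⟨e, -⟩ := T.exists_embedding_of_lt (H := H) (f := ![i, j, k, l])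
    (by intro a b hab
        fin_cases a <;> fin_cases b <;>
          first
          | exact absurd hab (by decide)
          | exact h01.2
          | exact h02.2
          | exact h12.2
          | exact h03.2
          | exact h13.2
          | exact h23.2)
    (by intro a b hab
        fin_cases a <;> fin_cases b <;>
          first
          | exact absurd hab (by decide)
          | exact h01.1
          | exact h02.1
          | exact h12.1
          | exact h03.1
          | exact h13.1
          | exact h23.1)
  exact ⟨e⟩

theorem nonempty_embedding_of_fin_four {H : SimpleGraph (Fin 4)} (h : H.CliqueFree 3)
    (h' : Hᶜ.CliqueFree 3) : Nonempty (H ↪g cycleGraph 5) ∨ Nonempty (H ↪g cycleGraph 4) ∨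
      Nonempty (H ↪g (cycleGraph 4)ᶜ) := by
  classical
  have key := hasFour_of_notAllEqual (decide (H.Adj 0 1)) (decide (H.Adj 0 2)) (decide (H.Adj 1 2))
      (decide (H.Adj 0 3)) (decide (H.Adj 1 3)) (decide (H.Adj 2 3))
    (notAllEqual_of_cliqueFree h h' (by decide) (by decide) (by decide))
    (notAllEqual_of_cliqueFree h h' (by decide) (by decide) (by decide))
    (notAllEqual_of_cliqueFree h h' (by decide) (by decide) (by decide))
    (notAllEqual_of_cliqueFree h h' (by decide) (by decide) (by decide))
  exact key.imp HasFour.nonempty_embedding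
    (Or.imp HasFour.nonempty_embedding HasFour.nonempty_embedding)

theorem nonempty_embedding_of_fin_three {H : SimpleGraph (Fin 3)} (h : H.CliqueFree 3)
    (h' : Hᶜ.CliqueFree 3) : Nonempty (H ↪g cycleGraph 5) := by
  classical
  obtain ⟨i, j, h01, k, h02, h12⟩ := exists_three_of_notAllEqual _ _ _
    (notAllEqual_of_cliqueFree h h' (a := 0) (b := 1) (c := 2) (by decide) (by decide) (by decide))
  simp only [Matches, decide_eq_true_eq] at h01 h02 h12
  obtain ⟨e, -⟩ := (cycleGraph 5).exists_embedding_of_lt (H := H) (f := ![i, j, k])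
    (by intro a b hab
        fin_cases a <;> fin_cases b <;>
          first
          | exact absurd hab (by decide)
          | exact h01.2
          | exact h02.2
          | exact h12.2)
    (by intro a b hab
        fin_cases a <;> fin_cases b <;>
          first
          | exact absurd hab (by decide)
          | exact h01.1
          | exact h02.1
          | exact h12.1)
  exact ⟨e⟩

theorem nonempty_embedding_of_fin_two (H : SimpleGraph (Fin 2)) :
    Nonempty (H ↪g cycleGraph 5) := by
  classical
  obtain ⟨i, j, h01⟩ := exists_two (decide (H.Adj 0 1))
  simp only [Matches, decide_eq_true_eq] at h01
  obtain ⟨e, -⟩ := (cycleGraph 5).exists_embedding_of_lt (H := H) (f := ![i, j])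
    (by intro a b hab
        fin_cases a <;> fin_cases b <;>
          first
          | exact absurd hab (by decide)
          | exact h01.2)
    (by intro a b hab
        fin_cases a <;> fin_cases b <;>
          first
          | exact absurd hab (by decide)
          | exact h01.1)
  exact ⟨e⟩

theorem nonempty_embedding_of_subsingleton {W : Type u} [Subsingleton W] (H : SimpleGraph W) :
    Nonempty (H ↪g cycleGraph 5) :=
  ⟨⟨⟨fun _ => 0, fun _ _ _ => Subsingleton.elim _ _⟩, fun {a b} => by
    have : a = b := Subsingleton.elim _ _
    simp [this]⟩⟩

theorem card_nbr_le_two {W : Type u} [Fintype W] {H : SimpleGraph W} (h : H.CliqueFree 3)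
    (h' : Hᶜ.CliqueFree 3) (v : W) : #(H.nbr v) ≤ 2 := by
  by_contra hlt
  obtain ⟨a, ha, b, hb, c, hc, hab, hac, hbc⟩ := Finset.two_lt_card.mp (not_le.mp hlt)
  rw [mem_nbr] at ha hb hc
  exact not_adj_all_of_cliqueFree h'
    ⟨hab, fun hh => not_adj_all_of_cliqueFree h ha hb hh⟩
    ⟨hac, fun hh => not_adj_all_of_cliqueFree h ha hc hh⟩
    ⟨hbc, fun hh => not_adj_all_of_cliqueFree h hb hc hh⟩

theorem card_nbr_add_card_nbr_compl {W : Type u} [Fintype W] (H : SimpleGraph W) (v : W) :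
    #(H.nbr v) + #(Hᶜ.nbr v) + 1 = Fintype.card W := by
  classical
  have hdisj : Disjoint (H.nbr v) (Hᶜ.nbr v) := Finset.disjoint_left.mpr fun x hx hx' =>
    (mem_nbr.mp hx').2 (mem_nbr.mp hx)
  have hv : v ∉ H.nbr v ∪ Hᶜ.nbr v := by simp
  rw [← Finset.card_union_of_disjoint hdisj, ← Finset.card_insert_of_notMem hv, ← Finset.card_univ]
  congr 1
  ext x
  simp only [Finset.mem_insert, Finset.mem_union, mem_nbr, compl_adj, Finset.mem_univ, iff_true]
  by_cases hx : x = v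
  · exact Or.inl hx
  · by_cases hvx : H.Adj v x
    · exact Or.inr (Or.inl hvx)
    · exact Or.inr (Or.inr ⟨fun hh => hx hh.symm, hvx⟩)

theorem nonempty_embedding_of_card_eq_five {W : Type u} [Fintype W] {H : SimpleGraph W}
    (h : H.CliqueFree 3) (h' : Hᶜ.CliqueFree 3) (hW : Fintype.card W = 5) :
    Nonempty (H ↪g cycleGraph 5) := by
  classical
  have h'' : Hᶜᶜ.CliqueFree 3 := by rwa [compl_compl]
  have hcard : ∀ v, #(H.nbr v) = 2 ∧ #(Hᶜ.nbr v) = 2 := fun v => by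
    have h1 := card_nbr_le_two h h' v
    have h2 := card_nbr_le_two h' h'' v
    have h3 := card_nbr_add_card_nbr_compl H v
    omega
  obtain ⟨v⟩ : Nonempty W := Fintype.card_pos_iff.mp (by omega)
  obtain ⟨a, b, hab, hN⟩ := Finset.card_eq_two.mp (hcard v).1
  obtain ⟨p, q, hpq, hN'⟩ := Finset.card_eq_two.mp (hcard v).2
  have hva : H.Adj v a := mem_nbr.mp (by rw [hN]; simp)
  have hvb : H.Adj v b := mem_nbr.mp (by rw [hN]; simp)
  have hvp : Hᶜ.Adj v p := mem_nbr.mp (by rw [hN']; simp)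
  have hvq : Hᶜ.Adj v q := mem_nbr.mp (by rw [hN']; simp)
  have hnab : ¬ H.Adj a b := fun hh => not_adj_all_of_cliqueFree h hva hvb hh
  have hpq' : H.Adj p q := by
    by_contra hh
    exact not_adj_all_of_cliqueFree h' hvp hvq ⟨hpq, hh⟩
  have hall : ∀ x, x = v ∨ x = a ∨ x = b ∨ x = p ∨ x = q := by
    intro x
    by_cases hx : x = v
    · exact Or.inl hx
    by_cases hvx : H.Adj v x
    · have : x ∈ H.nbr v := mem_nbr.mpr hvx
      rw [hN] at this
      simp at this
      tauto
    · have : x ∈ Hᶜ.nbr v := mem_nbr.mpr ⟨fun hh => hx hh.symm, hvx⟩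
      rw [hN'] at this
      simp at this
      tauto
  -- After choosing the names, `v a p q b` is the cycle.
  have main : ∀ p q : W, Hᶜ.Adj v p → Hᶜ.Adj v q → H.Adj p q → H.Adj a p →
      Nonempty (H ↪g cycleGraph 5) := by
    intro p q hvp hvq hpq' hap
    have haq : ¬ H.Adj a q := fun hh => not_adj_all_of_cliqueFree h hap hh hpq'
    have hbq : H.Adj b q := by
      by_contra hh
      exact not_adj_all_of_cliqueFree h' (a := a) (b := b) (c := q) ⟨hab, hnab⟩
        ⟨fun he => hvq.2 (he ▸ hva), haq⟩ ⟨fun he => hvq.2 (he ▸ hvb), hh⟩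
    have hbp : ¬ H.Adj b p := fun hh => not_adj_all_of_cliqueFree h hh hbq hpq'
    obtain ⟨e, he⟩ := H.exists_cycleGraph_five_embedding hva hap hpq' hbq.symm hvb.symm hvp.2 haq
      (mt Adj.symm hbp) (mt Adj.symm hvq.2) (mt Adj.symm hnab)
    have hbij : Function.Bijective e :=
      (Fintype.bijective_iff_injective_and_card e).mpr ⟨e.injective, by simp [hW]⟩
    exact ⟨(RelIso.ofSurjective e hbij.2).symm.toRelEmbedding⟩
  by_cases hap : H.Adj a p
  · exact main p q hvp hvq hpq' hap
  · refine main q p hvq hvp hpq'.symm ?_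
    -- `a` has a second neighbour besides `v`, which is neither `b` nor `p`.
    obtain ⟨x, hx, hxv⟩ : ∃ x ∈ H.nbr a, x ≠ v :=
      Finset.exists_mem_ne (by rw [(hcard a).1]; norm_num) v
    rw [mem_nbr] at hx
    rcases hall x with rfl | rfl | rfl | rfl | rfl
    · exact absurd rfl hxv
    · exact absurd hx (H.irrefl)
    · exact absurd hx hnab
    · exact absurd hx hap
    · exact hx

/-- A graph such that neither it nor its complement contains a triangle is an induced subgraph of
the five-cycle, the four-cycle or the complement of the four-cycle. -/
theorem nonempty_embedding_of_cliqueFree {W : Type u} [Finite W] {H : SimpleGraph W}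
    (h : H.CliqueFree 3) (h' : Hᶜ.CliqueFree 3) : Nonempty (H ↪g cycleGraph 5) ∨
      Nonempty (H ↪g cycleGraph 4) ∨ Nonempty (H ↪g (cycleGraph 4)ᶜ) := by
  classical
  have := Fintype.ofFinite W
  obtain hW | ⟨⟨v⟩⟩ := isEmpty_or_nonempty W
  · exact Or.inl (nonempty_embedding_of_subsingleton H)
  have h'' : Hᶜᶜ.CliqueFree 3 := by rwa [compl_compl]
  have hle : Fintype.card W ≤ 5 := by
    have h1 := card_nbr_le_two h h' v
    have h2 := card_nbr_le_two h' h'' v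
    have h3 := card_nbr_add_card_nbr_compl H v
    omega
  have htransfer : ∀ k, Fintype.card W = k → ∃ H₀ : SimpleGraph (Fin k), H₀.CliqueFree 3 ∧
      H₀ᶜ.CliqueFree 3 ∧ Nonempty (H ↪g H₀) := by
    intro k hk
    let e : W ≃ Fin k := Fintype.equivFinOfCardEq hk
    let i : H.comap e.symm ≃g H := Iso.comap e.symm H
    exact ⟨H.comap e.symm, h.comap ⟨i.toEmbedding.toCopy⟩,
      h'.comap ⟨(Embedding.complEquiv i.toEmbedding).toCopy⟩, ⟨i.symm.toEmbedding⟩⟩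
  interval_cases hk : Fintype.card W
  · exact Or.inl (have := (Fintype.card_le_one_iff_subsingleton (α := W)).mp (by omega)
      nonempty_embedding_of_subsingleton H)
  · exact Or.inl (have := (Fintype.card_le_one_iff_subsingleton (α := W)).mp (by omega)
      nonempty_embedding_of_subsingleton H)
  · obtain ⟨H₀, -, -, ⟨e⟩⟩ := htransfer 2 rfl
    exact Or.inl ((nonempty_embedding_of_fin_two H₀).map e.trans)
  · obtain ⟨H₀, h1, h2, ⟨e⟩⟩ := htransfer 3 rfl
    exact Or.inl ((nonempty_embedding_of_fin_three h1 h2).map e.trans)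
  · obtain ⟨H₀, h1, h2, ⟨e⟩⟩ := htransfer 4 rfl
    exact (nonempty_embedding_of_fin_four h1 h2).imp (Nonempty.map e.trans)
      (Or.imp (Nonempty.map e.trans) (Nonempty.map e.trans))
  · exact Or.inl (nonempty_embedding_of_card_eq_five h h' hk)

end Classification

/-! ### From sparse graphs to all graphs -/

section Saturation

variable {V : Type v}

/-- Every sparse expanding graph contains many copies of `H`. -/
def ManyCopiesIfExpanding {h : ℕ} (H : SimpleGraph (Fin h)) : Prop :=
  ∀ (V : Type v) [Fintype V] (G : SimpleGraph V) (c : ℝ), G.IsExpanding c →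
    c ^ 18 * (Fintype.card V : ℝ) ^ h ≤ Nat.card (H ↪g G)

/-- A set of small maximum degree yields many copies of `H` or a sparse pair. -/
theorem ManyCopiesIfExpanding.copies_or_sparse_pair {h : ℕ} {H : SimpleGraph (Fin h)}
    (hH : ManyCopiesIfExpanding.{v} H) [Fintype V] (G : SimpleGraph V) {X : Finset V} (hX2 : 2 ≤ #X)
    (hX : ∀ x ∈ X, G.degInto x X ≤ 1 / 40 * #X) {c : ℝ} (hc : 0 < c) (hc1 : c ≤ 1 / 200) :
    c ^ 18 * (#X : ℝ) ^ h ≤ Nat.card (H ↪g G) ∨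
      ∃ A B : Finset V, Disjoint A B ∧ c ^ 18 * #X ≤ #A ∧ (#X : ℝ) / 40 ≤ #B ∧
        G.edgeSum A B ≤ c * #A * #B := by
  classical
  let φ : {x // x ∈ X} ↪ V := Function.Embedding.subtype _
  have hcard : Fintype.card {x // x ∈ X} = #X := Fintype.card_coe X
  by_cases hexp : (G.comap φ).IsExpanding c
  · left
    have h1 := hH _ (G.comap φ) c hexp
    rw [hcard] at h1
    refine h1.trans (Nat.cast_le.mpr ?_)
    have : Finite (H ↪g G) := Finite.of_injective (fun f => (f : Fin h → V)) DFunLike.coe_injective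
    refine Nat.card_le_card_of_injective (fun e => (Embedding.comap φ G).comp e) fun e e' hee => ?_
    ext x
    have := congrArg (fun f : H ↪g G => f x) hee
    exact this
  · right
    by_contra hno
    refine hexp ⟨hc, hc1, by rw [hcard]; exact hX2, fun v => ?_, fun A B hAB hA hB => ?_⟩
    · rw [hcard]
      have h1 : (G.comap φ).degInto v Finset.univ = G.degInto v X := by
        rw [degInto, degInto, ← Finset.sum_coe_sort X]
        rfl
      rw [h1]
      linarith [hX v v.2]
    · rw [hcard] at hA hB
      by_contra hlt
      push Not at hlt
      refine hno ⟨A.map φ, B.map φ, (Finset.disjoint_map φ).mpr hAB, by rwa [Finset.card_map],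
        by rwa [Finset.card_map], ?_⟩
      rw [Finset.card_map, Finset.card_map]
      refine le_trans (le_of_eq ?_) hlt
      simp only [edgeSum, degInto, Finset.sum_map]
      rfl

theorem edgeSum_add_edgeSum_compl (G : SimpleGraph V) {A B : Finset V} (hAB : Disjoint A B) :
    G.edgeSum A B + Gᶜ.edgeSum A B = #A * #B := by
  have h1 : ∀ a ∈ A, ∀ b ∈ B, G.adjInd a b + Gᶜ.adjInd a b = 1 := by
    intro a ha b hb
    have hab : a ≠ b := fun hh => Finset.disjoint_left.mp hAB ha (hh ▸ hb)
    by_cases h : G.Adj a b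
    · rw [(Gᶜ.adjInd_eq_zero).mpr (fun hh => hh.2 h)]
      simp [adjInd, h]
    · rw [(G.adjInd_eq_zero).mpr h]
      simp [adjInd, h, hab]
  simp only [edgeSum, degInto, ← Finset.sum_add_distrib]
  rw [Finset.sum_congr rfl fun a ha => Finset.sum_congr rfl fun b hb => h1 a ha b hb]
  simp

theorem edgeSum_singleton_or (G : SimpleGraph V) (x y : V) :
    G.edgeSum {x} {y} = 0 ∨ Gᶜ.edgeSum {x} {y} = 0 := by
  simp only [edgeSum, degInto, Finset.sum_singleton, adjInd_eq_zero, compl_adj]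
  tauto

theorem isSparsePair_of_edgeSum_le {G : SimpleGraph V} {c : ℝ} {A B : Finset V}
    (hAB : Disjoint A B) (h : G.edgeSum A B ≤ c * #A * #B) : G.IsSparsePair c A B :=
  ⟨hAB, by rwa [← edgeSum_eq_edgesBetween]⟩

theorem isDensePair_of_edgeSum_compl_le {G : SimpleGraph V} {c : ℝ} {A B : Finset V}
    (hAB : Disjoint A B) (h : Gᶜ.edgeSum A B ≤ c * #A * #B) : G.IsDensePair (1 - c) A B := by
  refine ⟨hAB, ?_⟩
  rw [← edgeSum_eq_edgesBetween]
  linarith [G.edgeSum_add_edgeSum_compl hAB]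

theorem card_embedding_compl {W : Type u} (H : SimpleGraph W) (G : SimpleGraph V) :
    Nat.card (Hᶜ ↪g Gᶜ) = Nat.card (H ↪g G) :=
  Nat.card_congr Embedding.complEquiv.symm

/-- If sparse expanding graphs contain many copies of `H` and many copies of its complement, then
`H` has the saturation property: by Rödl's theorem, a graph with few copies of `H` has a
linear-sized set of small maximum degree in the graph or its complement. -/
theorem hasSaturationProperty_of_manyCopies {h : ℕ} {H : SimpleGraph (Fin h)}
    (hH : ManyCopiesIfExpanding.{v} H) (hH' : ManyCopiesIfExpanding.{v} Hᶜ) :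
    HasSaturationProperty.{0, v} H := by
  classical
  obtain ⟨δ, hδ, hhom⟩ := hasHomogeneousSets.{v} H (α := 1 / 160) (β := 1 / 160)
    (by norm_num) (by norm_num)
  set κ : ℝ := (1 / 200) ^ 18 with hκ
  have hκ0 : 0 < κ := by positivity
  have hκ1 : κ ≤ 1 := by rw [hκ]; norm_num
  set ε := min (min δ (δ / 160)) (min (κ * (δ / 4)) (κ * (δ / 4) ^ h)) with hε
  have hε1 : ε ≤ δ := (min_le_left _ _).trans (min_le_left _ _)
  have hε2 : ε ≤ δ / 160 := (min_le_left _ _).trans (min_le_right _ _)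
  have hε3 : ε ≤ κ * (δ / 4) := (min_le_right _ _).trans (min_le_left _ _)
  have hε4 : ε ≤ κ * (δ / 4) ^ h := (min_le_right _ _).trans (min_le_right _ _)
  have hε0 : 0 < ε := by positivity
  refine ⟨ε, ((18 : ℕ) : ℝ), hε0, by norm_num, fun V _ G hV c hc0 hc1 => ?_⟩
  have := Fintype.ofFinite V
  rw [Real.rpow_natCast]
  simp only [IsSaturated, IsSizePair, Nat.card_eq_fintype_card (α := V), Nat.card_fin]
  rw [Nat.card_eq_fintype_card] at hV
  set n : ℝ := (Fintype.card V : ℝ) with hn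
  have hn0 : 0 < n := by rw [hn]; exact_mod_cast (by omega : 0 < Fintype.card V)
  rcases hc0.eq_or_lt with rfl | hc
  · left
    simp
  have hc18 : c ^ 18 ≤ 1 := pow_le_one₀ hc0 hc1
  by_cases hsmall : δ * n < 4
  · -- The graph is so small that single vertices form a large enough pair.
    right
    obtain ⟨x, y, hxy⟩ := Fintype.one_lt_card_iff.mp hV
    have hεn : ε * n ≤ 1 := by nlinarith
    have hdisj : Disjoint ({x} : Finset V) {y} := by simpa using hxy
    refine ⟨{x}, {y}, ⟨hdisj, ?_, by simpa using hεn⟩, ?_⟩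
    · rw [Finset.card_singleton, Nat.cast_one]
      calc ε * c ^ 18 * n = c ^ 18 * (ε * n) := by ring
        _ ≤ 1 * 1 := by gcongr
        _ = 1 := one_mul 1
    · rcases G.edgeSum_singleton_or x y with h0 | h0
      · exact Or.inl (isSparsePair_of_edgeSum_le hdisj (by rw [h0]; positivity))
      · exact Or.inr (isDensePair_of_edgeSum_compl_le hdisj (by rw [h0]; positivity))
  push Not at hsmall
  by_cases hfew : (Nat.card (H ↪g G) : ℝ) < δ * n ^ h
  swap
  · left
    push Not at hfew
    refine le_trans ?_ hfew
    calc ε * c ^ 18 * n ^ h ≤ δ * 1 * n ^ h := by gcongr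
      _ = _ := by ring
  set k := ⌊δ * n⌋₊ with hk
  have hk1 : (k : ℝ) ≤ δ * n := Nat.floor_le (by positivity)
  have hk2 : δ * n < k + 1 := Nat.lt_floor_add_one _
  have hk4 : 4 ≤ k := Nat.le_floor (by exact_mod_cast hsmall)
  have hk4' : (4 : ℝ) ≤ k := by exact_mod_cast hk4
  obtain ⟨X, -, hXk, hX⟩ := hhom V G Finset.univ k (by rwa [Finset.card_univ])
    (by rwa [Finset.card_univ])
  -- A parameter below the threshold `1 / 200` and comparable with `c`.
  set c₀ := 1 / 200 * c with hc₀
  have hc₀0 : 0 < c₀ := by positivity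
  have hc₀1 : c₀ ≤ 1 / 200 := by linarith
  have hc₀c : c₀ ≤ c := by linarith
  have hc₀18 : c₀ ^ 18 = κ * c ^ 18 := by rw [hc₀, mul_pow]
  have hsize : ∀ Y : Finset V, (#X : ℝ) / 2 ≤ #Y → 2 ≤ #Y ∧ δ / 4 * n ≤ #Y := by
    intro Y hY
    rw [hXk] at hY
    constructor
    · have : (2 : ℝ) ≤ #Y := by linarith
      exact_mod_cast this
    · linarith
  have hcopies : ∀ Y : Finset V, δ / 4 * n ≤ #Y → ε * c ^ 18 * n ^ h ≤ c₀ ^ 18 * (#Y : ℝ) ^ h := by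
    intro Y hY
    rw [hc₀18]
    calc ε * c ^ 18 * n ^ h ≤ κ * (δ / 4) ^ h * c ^ 18 * n ^ h := by gcongr
      _ = κ * c ^ 18 * (δ / 4 * n) ^ h := by rw [mul_pow]; ring
      _ ≤ _ := by gcongr
  have hpair : ∀ Y A B : Finset V, δ / 4 * n ≤ #Y → c₀ ^ 18 * #Y ≤ #A → (#Y : ℝ) / 40 ≤ #B →
      ε * c ^ 18 * n ≤ #A ∧ ε * n ≤ #B := by
    intro Y A B hY hA hB
    constructor
    · refine le_trans ?_ hA
      rw [hc₀18]
      calc ε * c ^ 18 * n ≤ κ * (δ / 4) * c ^ 18 * n := by gcongr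
        _ = κ * c ^ 18 * (δ / 4 * n) := by ring
        _ ≤ _ := by gcongr
    · refine le_trans ?_ hB
      have : ε * n ≤ δ / 160 * n := by gcongr
      linarith
  rcases hX with hX | hX
  · obtain ⟨Y, -, hY, hdeg⟩ := G.exists_subset_degInto_le (α := 1 / 160) (by norm_num)
      (by rw [hXk]; exact hX)
    obtain ⟨hY2, hYn⟩ := hsize Y hY
    rcases hH.copies_or_sparse_pair G hY2 (fun y hy => (hdeg y hy).trans_eq (by ring)) hc₀0 hc₀1
      with h1 | ⟨A, B, hAB, hA, hB, hE⟩
    · exact Or.inl ((hcopies Y hYn).trans h1)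
    · obtain ⟨h1, h2⟩ := hpair Y A B hYn hA hB
      exact Or.inr ⟨A, B, ⟨hAB, h1, h2⟩, Or.inl (isSparsePair_of_edgeSum_le hAB
        (hE.trans (by gcongr)))⟩
  · obtain ⟨Y, -, hY, hdeg⟩ := Gᶜ.exists_subset_degInto_le (α := 1 / 160) (by norm_num)
      (by rw [hXk]; exact hX)
    obtain ⟨hY2, hYn⟩ := hsize Y hY
    rcases hH'.copies_or_sparse_pair Gᶜ hY2 (fun y hy => (hdeg y hy).trans_eq (by ring)) hc₀0 hc₀1
      with h1 | ⟨A, B, hAB, hA, hB, hE⟩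
    · rw [card_embedding_compl] at h1
      exact Or.inl ((hcopies Y hYn).trans h1)
    · obtain ⟨h1, h2⟩ := hpair Y A B hYn hA hB
      exact Or.inr ⟨A, B, ⟨hAB, h1, h2⟩, Or.inr (isDensePair_of_edgeSum_compl_le hAB
        (hE.trans (by gcongr)))⟩

/-- A copy of `H'` is determined by its restriction to an induced subgraph `H` and by the images of
the remaining vertices. -/
theorem card_embedding_le_mul_pow {W W' : Type*} [Finite W'] [Finite V] {H : SimpleGraph W}
    {H' : SimpleGraph W'} (i : H ↪g H') (G : SimpleGraph V) :
    Nat.card (H' ↪g G) ≤ Nat.card (H ↪g G) * Nat.card V ^ (Nat.card W' - Nat.card W) := by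
  classical
  have : Finite W := Finite.of_injective i i.injective
  have : Finite (H ↪g G) := Finite.of_injective (fun f => (f : W → V)) DFunLike.coe_injective
  have hcard : Nat.card {x // x ∉ Set.range i} = Nat.card W' - Nat.card W := by
    have h1 := Set.ncard_add_ncard_compl (Set.range i)
    have h2 : (Set.range i).ncard = Nat.card W := by
      rw [← Nat.card_coe_set_eq]
      exact (Nat.card_congr (Equiv.ofInjective i i.injective)).symm
    have h3 : ((Set.range i)ᶜ).ncard = Nat.card {x // x ∉ Set.range i} :=
      (Nat.card_coe_set_eq _).symm
    omega
  rw [← hcard, ← Nat.card_fun, ← Nat.card_prod]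
  refine Nat.card_le_card_of_injective
    (fun e => (e.comp i, fun x : {x // x ∉ Set.range i} => e x)) fun e e' hee => ?_
  ext x
  obtain ⟨h1, h2⟩ := Prod.mk.inj hee
  by_cases hx : x ∈ Set.range i
  · obtain ⟨w, rfl⟩ := hx
    exact congrArg (fun f : H ↪g G => f w) h1
  · exact congrFun h2 ⟨x, hx⟩

theorem HasSaturationProperty.of_embedding {W : Type u} {h : ℕ} {H : SimpleGraph W}
    {H' : SimpleGraph (Fin h)} (i : H ↪g H') (hH' : HasSaturationProperty.{0, v} H') :
    HasSaturationProperty.{u, v} H := by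
  obtain ⟨ε, s, hε, hs, hmain⟩ := hH'
  refine ⟨ε, s, hε, hs, fun V _ G hV c hc0 hc1 => (hmain V G hV c hc0 hc1).imp_left fun hsat => ?_⟩
  have hV0 : (0 : ℝ) < Nat.card V := by exact_mod_cast (by omega : 0 < Nat.card V)
  have hWh : Nat.card W ≤ Nat.card (Fin h) := Nat.card_le_card_of_injective i i.injective
  have h1 : (Nat.card (H' ↪g G) : ℝ) ≤
      Nat.card (H ↪g G) * (Nat.card V : ℝ) ^ (Nat.card (Fin h) - Nat.card W) := by
    exact_mod_cast card_embedding_le_mul_pow i G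
  have h2 := le_trans hsat h1
  rw [← Nat.sub_add_cancel hWh, pow_add, Nat.add_sub_cancel, mul_comm ((Nat.card V : ℝ) ^ _),
    ← mul_assoc] at h2
  exact le_of_mul_le_mul_right h2 (by positivity)

theorem manyCopies_compl_cycleGraph_five : ManyCopiesIfExpanding.{v} (cycleGraph 5)ᶜ := by
  intro V _ G c hG
  have hiso : Nonempty ((cycleGraph 5)ᶜ ≃g cycleGraph 5) :=
    ⟨⟨⟨fun x => 2 * x, fun x => 3 * x, by decide, by decide⟩, by decide⟩⟩
  obtain ⟨i⟩ := hiso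
  have : Nat.card ((cycleGraph 5)ᶜ ↪g G) = Nat.card (cycleGraph 5 ↪g G) :=
    Nat.card_congr ⟨fun e => e.comp i.symm.toEmbedding, fun e => e.comp i.toEmbedding,
      fun e => by ext x; simp, fun e => by ext x; simp⟩
  rw [this]
  exact hG.card_cycleGraph_five_ge

theorem hasSaturationProperty_cycleGraph_five : HasSaturationProperty.{0, v} (cycleGraph 5) :=
  hasSaturationProperty_of_manyCopies (fun _ _ _ _ hG => hG.card_cycleGraph_five_ge)
    manyCopies_compl_cycleGraph_five

theorem hasSaturationProperty_cycleGraph_four : HasSaturationProperty.{0, v} (cycleGraph 4) :=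
  hasSaturationProperty_of_manyCopies (fun _ _ _ _ hG => hG.card_cycleGraph_four_ge)
    (fun _ _ _ _ hG => hG.card_compl_cycleGraph_four_ge)

theorem hasSaturationProperty_compl_cycleGraph_four :
    HasSaturationProperty.{0, v} (cycleGraph 4)ᶜ :=
  hasSaturationProperty_of_manyCopies (fun _ _ _ _ hG => hG.card_compl_cycleGraph_four_ge)
    (by rw [compl_compl]; exact fun _ _ _ _ hG => hG.card_cycleGraph_four_ge)

end Saturation

/-! ### From the saturation property to complete or anticomplete pairs -/

section LinearPair

variable {V : Type v}

open Classical in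
/-- In a `c`-sparse pair, any number of vertices up to `1 / (2 c)` can be chosen on one side so that
at least half of the other side has no neighbour among them. -/
theorem exists_anticomplete_of_edgeSum_le (G : SimpleGraph V) {c : ℝ} {A B : Finset V}
    (hAB : Disjoint A B) (h : G.edgeSum A B ≤ c * #A * #B) {k : ℕ} (hk : k ≤ #A)
    (hck : c * k ≤ 1 / 2) :
    ∃ A' ⊆ A, ∃ B' ⊆ B, #A' = k ∧ (#B : ℝ) / 2 ≤ #B' ∧ G.IsAnticompletePair A' B' := by
  obtain ⟨A', hA', hA'k, hsum⟩ := exists_subset_sum_le (A := A) (fun a => G.degInto a B)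
    (l := c * #B) hk (by unfold edgeSum at h; linarith)
  set B' := B.filter fun b => ∀ a ∈ A', ¬ G.Adj a b with hB'
  refine ⟨A', hA', B', Finset.filter_subset _ _, hA'k, ?_, ?_⟩
  · have h1 : (#(B.filter fun b => ¬ ∀ a ∈ A', ¬ G.Adj a b) : ℝ) ≤ G.edgeSum B A' := by
      calc (#(B.filter fun b => ¬ ∀ a ∈ A', ¬ G.Adj a b) : ℝ)
          = ∑ b ∈ B.filter (fun b => ¬ ∀ a ∈ A', ¬ G.Adj a b), (1 : ℝ) := by simp
        _ ≤ ∑ b ∈ B.filter (fun b => ¬ ∀ a ∈ A', ¬ G.Adj a b), G.degInto b A' := by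
            refine Finset.sum_le_sum fun b hb => ?_
            have hb2 := (Finset.mem_filter.mp hb).2
            push Not at hb2
            obtain ⟨a, ha, hab⟩ := hb2
            have h2 : G.adjInd b a = 1 := if_pos hab.symm
            rw [← h2]
            exact Finset.single_le_sum (f := fun a => G.adjInd b a)
              (fun a _ => G.adjInd_nonneg b a) ha
        _ ≤ _ := G.edgeSum_mono (Finset.filter_subset _ _) subset_rfl
    have h2 : G.edgeSum B A' ≤ c * #B * k := by rw [edgeSum_comm]; exact hsum
    have h3 : (#B' : ℝ) + #(B.filter fun b => ¬ ∀ a ∈ A', ¬ G.Adj a b) = #B := by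
      exact_mod_cast Finset.card_filter_add_card_filter_not (fun b => ∀ a ∈ A', ¬ G.Adj a b)
    have h4 : c * #B * k ≤ 1 / 2 * #B := by
      calc c * #B * k = c * k * #B := by ring
        _ ≤ _ := by gcongr
    linarith
  · exact ⟨Disjoint.mono hA' (Finset.filter_subset _ _) hAB,
      fun a ha b hb => (Finset.mem_filter.mp hb).2 a ha⟩

/-- The sparsity parameter is chosen as `n ^ (-1 / (s + 1))`, so that the side of size `c ^ s * n`
and the bound `1 / (2 c)` are both of order `n ^ (1 / (s + 1))`. -/
theorem HasSaturationProperty.hasLinearPairProperty {W : Type u} {H : SimpleGraph W}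
    (hH : HasSaturationProperty.{u, v} H) : HasLinearPairProperty.{u, v} H := by
  classical
  obtain ⟨ε, s, hε, hs, hmain⟩ := hH
  set τ := 1 / (s + 1) with hτ
  have hτ0 : 0 < τ := by positivity
  have hτ1 : τ ≤ 1 := by rw [hτ, div_le_one (by positivity)]; linarith
  set N : ℝ := 4 ^ (1 / τ) with hN
  have hN1 : 1 ≤ N := Real.one_le_rpow (by norm_num) (by positivity)
  set ρ := min (min τ (1 / N)) (min (ε / 2) (1 / 4)) with hρ
  have hρτ : ρ ≤ τ := (min_le_left _ _).trans (min_le_left _ _)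
  have hρN : ρ ≤ 1 / N := (min_le_left _ _).trans (min_le_right _ _)
  have hρε : ρ ≤ ε / 2 := (min_le_right _ _).trans (min_le_left _ _)
  have hρ4 : ρ ≤ 1 / 4 := (min_le_right _ _).trans (min_le_right _ _)
  have hρ0 : 0 < ρ := by positivity
  refine ⟨ρ, hρ0, fun V _ G hV hfree => ?_⟩
  have := Fintype.ofFinite V
  set n : ℝ := (Nat.card V : ℝ) with hn
  have hn1 : 1 ≤ n := by rw [hn]; exact_mod_cast hV.le
  have hn0 : 0 < n := by linarith
  have hnρ : n ^ ρ ≤ n ^ τ := Real.rpow_le_rpow_of_exponent_le hn1 hρτ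
  by_cases hsmall : n < N
  · -- The graph is so small that single vertices form a large enough pair.
    obtain ⟨x, y, hxy⟩ := Fintype.one_lt_card_iff.mp (by rwa [Nat.card_eq_fintype_card] at hV)
    have hdisj : Disjoint ({x} : Finset V) {y} := by simpa using hxy
    have hρn : ρ * n ≤ 1 := by
      calc ρ * n ≤ 1 / N * N := by gcongr
        _ = 1 := by field_simp
    have hnn : n ^ ρ ≤ n := by
      calc n ^ ρ ≤ n ^ (1 : ℝ) := Real.rpow_le_rpow_of_exponent_le hn1 (by linarith)
        _ = n := Real.rpow_one n
    refine ⟨{x}, {y}, ⟨hdisj, ?_, by simpa using hρn⟩, ?_⟩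
    · rw [Finset.card_singleton, Nat.cast_one]
      exact le_trans (by gcongr) hρn
    · by_cases hadj : G.Adj x y
      · exact Or.inl ⟨hdisj, by simpa using hadj⟩
      · exact Or.inr ⟨hdisj, by simpa using hadj⟩
  push Not at hsmall
  set m := n ^ τ with hm
  have hm4 : 4 ≤ m := by
    calc (4 : ℝ) = N ^ τ := by
          rw [hN, ← Real.rpow_mul (by norm_num), one_div_mul_cancel hτ0.ne', Real.rpow_one]
      _ ≤ n ^ τ := by gcongr
  set c := m⁻¹ with hc
  have hm0 : 0 < m := by linarith
  have hc0 : 0 < c := by positivity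
  have hc1 : c ≤ 1 := inv_le_one_of_one_le₀ (by linarith)
  have hcs : c ^ s * n = m := by
    have h1 : τ + τ * s = 1 := by rw [hτ]; field_simp; ring
    have h2 : n = m * m ^ s := by
      rw [hm, ← Real.rpow_mul hn0.le, ← Real.rpow_add hn0, h1, Real.rpow_one]
    have h3 : 0 < m ^ s := Real.rpow_pos_of_pos hm0 s
    rw [hc, Real.inv_rpow hm0.le]
    calc (m ^ s)⁻¹ * n = (m ^ s)⁻¹ * (m * m ^ s) := by rw [← h2]
      _ = m := by field_simp
  have hnosat : ¬ G.IsSaturated (ε * c ^ s) H := by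
    have hempty : IsEmpty (H ↪g G) := not_nonempty_iff.mp hfree
    have h0 : Nat.card (H ↪g G) = 0 := Nat.card_of_isEmpty
    rw [IsSaturated, h0, Nat.cast_zero, not_le]
    have : 0 < c ^ s := Real.rpow_pos_of_pos hc0 s
    exact mul_pos (mul_pos hε this) (pow_pos hn0 _)
  obtain ⟨A, B, ⟨hAB, hA, hB⟩, hpair⟩ := (hmain V G hV c hc0.le hc1).resolve_left hnosat
  rw [mul_assoc, ← hn, hcs] at hA
  rw [← hn] at hB
  set k := min #A ⌊m / 2⌋₊ with hk
  have hkA : k ≤ #A := min_le_left _ _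
  have hck : c * k ≤ 1 / 2 := by
    have h1 : (k : ℝ) ≤ m / 2 :=
      (Nat.cast_le.mpr (min_le_right _ _)).trans (Nat.floor_le (by positivity))
    calc c * k ≤ c * (m / 2) := by gcongr
      _ = 1 / 2 := by rw [hc]; field_simp
  have hkm : ρ * n ^ ρ ≤ k := by
    have h0 : ρ * n ^ ρ ≤ ρ * m := by gcongr
    have h1 : ρ * m ≤ #A := by
      refine le_trans ?_ hA
      have : ρ ≤ ε := by linarith
      gcongr
    have h2 : ρ * m ≤ ⌊m / 2⌋₊ := by
      have h3 := Nat.lt_floor_add_one (m / 2)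
      nlinarith
    rw [hk, Nat.cast_min]
    exact le_min (h0.trans h1) (h0.trans h2)
  have hBn : ∀ B' : Finset V, (#B : ℝ) / 2 ≤ #B' → ρ * n ≤ #B' := by
    intro B' hB'
    have : ρ * n ≤ ε / 2 * n := by gcongr
    linarith
  rcases hpair with hp | hp
  · have hE := hp.2
    rw [← edgeSum_eq_edgesBetween] at hE
    obtain ⟨A', -, B', -, hA', hB', hanti⟩ := G.exists_anticomplete_of_edgeSum_le hAB hE hkA hck
    exact ⟨A', B', ⟨hanti.1, by rw [hA']; exact hkm, hBn B' hB'⟩, Or.inr hanti⟩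
  · have hE := hp.2
    rw [← edgeSum_eq_edgesBetween] at hE
    have hE' : Gᶜ.edgeSum A B ≤ c * #A * #B := by
      linarith [G.edgeSum_add_edgeSum_compl hAB]
    obtain ⟨A', -, B', -, hA', hB', hanti⟩ := Gᶜ.exists_anticomplete_of_edgeSum_le hAB hE' hkA hck
    refine ⟨A', B', ⟨hanti.1, by rw [hA']; exact hkm, hBn B' hB'⟩, Or.inl ⟨hanti.1, ?_⟩⟩
    intro a ha b hb
    by_contra hab
    exact hanti.2 a ha b hb ⟨fun hh => Finset.disjoint_left.mp hanti.1 ha (hh ▸ hb), hab⟩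

end LinearPair

end SimpleGraph

theorem mainTheorem11 :
    SimpleGraph.HasLinearPairProperty.{0, v} (SimpleGraph.cycleGraph 4) ∧
    SimpleGraph.HasLinearPairProperty.{0, v} (SimpleGraph.cycleGraph 4)ᶜ ∧
    ∀ (W : Type u) [Finite W] (H : SimpleGraph W),
      H.IsAlmostBipartite → Hᶜ.IsAlmostBipartite →
        SimpleGraph.HasSaturationProperty.{u, v} H := by
  refine ⟨SimpleGraph.hasSaturationProperty_cycleGraph_four.hasLinearPairProperty,
    SimpleGraph.hasSaturationProperty_compl_cycleGraph_four.hasLinearPairProperty,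
    fun W _ H hH hH' => ?_⟩
  rcases SimpleGraph.nonempty_embedding_of_cliqueFree hH.1 hH'.1 with ⟨⟨i⟩⟩ | ⟨⟨i⟩⟩ | ⟨⟨i⟩⟩
  · exact SimpleGraph.hasSaturationProperty_cycleGraph_five.of_embedding i
  · exact SimpleGraph.hasSaturationProperty_cycleGraph_four.of_embedding i
  · exact SimpleGraph.hasSaturationProperty_compl_cycleGraph_four.of_embedding i
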